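/- Let $n\ge 2$, let $\eta=\mathrm{diag}(-1,1,\dots,1)$ be the Minkowski form on $\mathbb R^n$ with coordinates indexed by $0,\dots,n-1$, let $O(1,n-1)\subset GL(n,\mathbb R)$ be the full Lorentz group, consisting of all $\Lambda$ with $\Lambda^T\eta\Lambda=\eta$, and let $L_+^\uparrow$ be the proper orthochronous Lorentz group, i.e. the subgroup of those $\Lambda\in O(1,n-1)$ with $\det\Lambda=1$ and $\Lambda_{00}>0$. Let $M$ be a smooth Hausdorff $n$-manifold with a smooth Lorentzian metric $g$ of signature $(-,+,\dots,+)$. Let $\pi:L(M)\to M$ be the bundle of linear frames $(e_0,\dots,e_{n-1})$, with the right action of $GL(n,\mathbb R)$. For a subgroup $H\subset GL(n,\mathbb R)$ let $pr:L(M)\to L(M)/H$ be the projection. Say that a subset $Q\subset L(M)$ *reduces $L(M)$ to $H$ with section* if: 1. $Q$ is a reduced subbundle of $L(M)$ with structure group $H$: $H$ is a Lie subgroup (an embedded submanifold) of $GL(n,\mathbb R)$, $Q$ is an embedded submanifold of $L(M)$ stable under the right action of $H$, and every point of $M$ has an open neighbourhood $U$ with a smooth $GL(n,\mathbb R)$-equivariant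 local trivialization $\pi^{-1}(U)\cong U\times GL(n,\mathbb R)$ over $U$ which maps $Q\cap\pi^{-1}(U)$ onto $U\times H$; 2. $L(M)/H$, with the quotient topology, is Hausdorff and carries a smooth manifold structure for which $pr$ is a smooth submersion; 3. there is exactly one map $s:M\to L(M)/H$ such that $s(\pi(u))=pr(u)$ for all $u\in Q$ (so $pr$ is constant on the fibres of $Q$), $s$ is a cross section of $L(M)/H\to M$, $s$ is smooth (for every smooth structure on $L(M)/H$ for which $pr$ is a smooth submersion), and $Q=pr^{-1}(s(M))$. Then: (a) The set $Q(M)$ of all pseudo-orthonormal frames, $g(e_a,e_b)=\eta_{ab}$, reduces $L(M)$ to $O(1,n-1)$ with section. (b) If $(M,g)$ is oriented and time-oriented, then the set $Q_+^\uparrow(M)$ of all positively oriented pseudo-orthonormal frames with future-pointing $e_0$ reduces $L(M)$ to $L_+^\uparrow$ with section. -/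

import Mathlib

open Bundle Set Topology
open scoped Manifold ContDiff

noncomputable section

/-! ### Minkowski space and the Lorentz groups -/

/-- The model space `ℝ^(d+1)`; the coordinate with index `0` is the time coordinate. -/
abbrev MSpace (d : ℕ) : Type := EuclideanSpace ℝ (Fin (d + 1))

/-- The standard basis vectors of `ℝ^(d+1)`. -/
def stdVec (d : ℕ) (a : Fin (d + 1)) : MSpace d := EuclideanSpace.single a 1

/-- The Minkowski form `η(v, w) = - v₀ w₀ + v₁ w₁ + ⋯ + v_d w_d`. -/
def minkowski {d : ℕ} (v w : MSpace d) : ℝ := -(v 0 * w 0) + ∑ i : Fin d, v i.succ * w i.succ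

/-- The general linear group `GL(d+1, ℝ)`, with Mathlib's Lie group structure on the units of the
algebra of endomorphisms of `ℝ^(d+1)`. -/
abbrev GLGroup (d : ℕ) : Type := (MSpace d →L[ℝ] MSpace d)ˣ

/-- The full Lorentz group `O(1, d)`. -/
def lorentzGroup (d : ℕ) : Subgroup (GLGroup d) where
  carrier := {A | ∀ v w, minkowski (A.val v) (A.val w) = minkowski v w}
  mul_mem' := by
    intro A B hA hB v w
    simp only [Units.val_mul, mul_apply_eq_comp]
    rw [hA, hB]
  one_mem' := by
    intro v w
    simp
  inv_mem' := by
    intro A hA v w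
    have key : ∀ v, A.val ((A⁻¹).val v) = v := fun v => by
      rw [← mul_apply_eq_comp, Units.mul_inv, one_apply_eq_self]
    rw [← hA, key, key]

/-- If `a` is timelike and future pointing, `b` is timelike and `η(a, b) < 0`, then `b` is future
pointing. -/
theorem pos_of_minkowski_neg {d : ℕ} {a b : MSpace d} (ha : minkowski a a < 0) (ha0 : 0 < a 0)
    (hb : minkowski b b < 0) (hab : minkowski a b < 0) : 0 < b 0 := by
  by_contra! hb0
  unfold minkowski at *
  have hcs := Finset.sum_mul_sq_le_sq_mul_sq Finset.univ
    (fun i : Fin d => a i.succ) (fun i : Fin d => b i.succ)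
  set S := ∑ i : Fin d, a i.succ * b i.succ
  have hA : ∑ i : Fin d, a i.succ ^ 2 < a 0 ^ 2 := by
    simp only [pow_two]; linarith
  have hB : ∑ i : Fin d, b i.succ ^ 2 < b 0 ^ 2 := by
    simp only [pow_two]; linarith
  have hA0 : 0 ≤ ∑ i : Fin d, a i.succ ^ 2 := Finset.sum_nonneg fun i _ => sq_nonneg _
  have hB0 : 0 ≤ ∑ i : Fin d, b i.succ ^ 2 := Finset.sum_nonneg fun i _ => sq_nonneg _
  have h1 : S ^ 2 ≤ (a 0 * b 0) ^ 2 := by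
    calc S ^ 2 ≤ _ := hcs
      _ ≤ a 0 ^ 2 * b 0 ^ 2 := by gcongr
      _ = _ := by ring
  have h2 : a 0 * b 0 ≤ 0 := mul_nonpos_of_nonneg_of_nonpos ha0.le hb0
  have h3 : -(a 0 * b 0) < -S := by linarith
  nlinarith

theorem minkowski_stdVec_zero {d : ℕ} (w : MSpace d) : minkowski (stdVec d 0) w = -(w 0) := by
  simp [minkowski, stdVec]

/-- The proper orthochronous Lorentz group `L₊^↑`: the Lorentz transformations of determinant `1`
whose time-time entry `A₀₀` is positive. -/
def properOrthochronous (d : ℕ) : Subgroup (GLGroup d) where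
  carrier := {A | A ∈ lorentzGroup d ∧ LinearMap.det (A.val : MSpace d →ₗ[ℝ] MSpace d) = 1 ∧
    0 < A.val (stdVec d 0) 0}
  mul_mem' := by
    rintro A B ⟨hA, hAd, hA0⟩ ⟨hB, hBd, hB0⟩
    refine ⟨mul_mem hA hB, ?_, ?_⟩
    · have : ((A * B).val : MSpace d →ₗ[ℝ] MSpace d) =
          (A.val : MSpace d →ₗ[ℝ] MSpace d) * (B.val : MSpace d →ₗ[ℝ] MSpace d) := rfl
      rw [this, map_mul, hAd, hBd, one_mul]
    · have e0 : minkowski (stdVec d 0) (stdVec d 0) < 0 := by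
        rw [minkowski_stdVec_zero]; simp [stdVec]
      have key := pos_of_minkowski_neg (a := A.val (stdVec d 0))
        (b := A.val (B.val (stdVec d 0))) (by rw [hA]; exact e0) hA0
        (by rw [hA, hB]; exact e0)
        (by rw [hA, minkowski_stdVec_zero]; linarith)
      simpa using key
  one_mem' := by
    refine ⟨one_mem _, ?_, ?_⟩
    · have : ((1 : GLGroup d).val : MSpace d →ₗ[ℝ] MSpace d) = 1 := rfl
      rw [this, map_one]
    · simp [stdVec]
  inv_mem' := by
    rintro A ⟨hA, hAd, hA0⟩
    have hAi := inv_mem hA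
    refine ⟨hAi, ?_, ?_⟩
    · have h1 : (A.val : MSpace d →ₗ[ℝ] MSpace d) * ((A⁻¹).val : MSpace d →ₗ[ℝ] MSpace d) = 1 := by
        ext v : 1
        change (A.val * (A⁻¹).val) v = v
        simp
      have h2 := congrArg LinearMap.det h1
      rw [map_mul, hAd, one_mul, map_one] at h2
      exact h2
    · have h1 : minkowski (stdVec d 0) ((A⁻¹).val (stdVec d 0)) =
          minkowski (A.val (stdVec d 0)) (stdVec d 0) := by
        rw [← hAi (A.val (stdVec d 0)), ← mul_apply_eq_comp, Units.inv_mul]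
        simp
      have h2 : minkowski (A.val (stdVec d 0)) (stdVec d 0) = -(A.val (stdVec d 0) 0) := by
        rw [← minkowski_stdVec_zero]
        simp only [minkowski, mul_comm]
      rw [minkowski_stdVec_zero, h2] at h1
      linarith

/-! ### The frame bundle -/

section FrameBundle

variable (d : ℕ) (M : Type*) [TopologicalSpace M] [ChartedSpace (MSpace d) M]
  [IsManifold 𝓘(ℝ, MSpace d) ∞ M]

/-- The total space of the vector bundle of linear maps from `ℝ^(d+1)` to the tangent spaces
of `M`. -/
abbrev TangentHom : Type _ :=
  TotalSpace (MSpace d →L[ℝ] MSpace d)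
    (fun x : M => Bundle.Trivial M (MSpace d) x →L[ℝ] TangentSpace 𝓘(ℝ, MSpace d) x)

theorem isOpen_frames : IsOpen {u : TangentHom d M | Function.Bijective u.2} := by
  rw [isOpen_iff_mem_nhds]
  intro u₀ hu₀
  let t := trivializationAt (MSpace d →L[ℝ] MSpace d)
    (fun x : M => Bundle.Trivial M (MSpace d) x →L[ℝ] TangentSpace 𝓘(ℝ, MSpace d) x) u₀.1
  have hO : IsOpen (t.source ∩ t ⁻¹' (Prod.snd ⁻¹'
      range ((↑) : (MSpace d ≃L[ℝ] MSpace d) → MSpace d →L[ℝ] MSpace d))) :=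
    t.continuousOn_toFun.isOpen_inter_preimage t.open_source
      (ContinuousLinearEquiv.isOpen.preimage continuous_snd)
  have key : ∀ u ∈ t.source, ((t u).2 ∈
      range ((↑) : (MSpace d ≃L[ℝ] MSpace d) → MSpace d →L[ℝ] MSpace d) ↔
        Function.Bijective u.2) := by
    intro u hu
    have hb : u.1 ∈ t.baseSet := t.mem_source.1 hu
    rw [hom_trivializationAt_baseSet] at hb
    have e : (t u).2 = ((trivializationAt (MSpace d) (TangentSpace 𝓘(ℝ, MSpace d))
        u₀.1).continuousLinearEquivAt ℝ u.1 hb.2 : _ →L[ℝ] _) ∘L u.2 ∘L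
        ((trivializationAt (MSpace d) (Bundle.Trivial M (MSpace d))
        u₀.1).continuousLinearEquivAt ℝ u.1 hb.1).symm := by
      have := hom_trivializationAt_apply (RingHom.id ℝ) (F₁ := MSpace d)
        (E₁ := Bundle.Trivial M (MSpace d)) (F₂ := MSpace d)
        (E₂ := (TangentSpace 𝓘(ℝ, MSpace d) : M → Type _)) u₀.1 u
      rw [this]
      exact ContinuousLinearMap.inCoordinates_eq hb.1 hb.2
    set L₂ := (trivializationAt (MSpace d) (TangentSpace 𝓘(ℝ, MSpace d))
        u₀.1).continuousLinearEquivAt ℝ u.1 hb.2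
    set L₁ := (trivializationAt (MSpace d) (Bundle.Trivial M (MSpace d))
        u₀.1).continuousLinearEquivAt ℝ u.1 hb.1
    have e' : ⇑(t u).2 = L₂ ∘ u.2 ∘ L₁.symm := by rw [e]; rfl
    have hbij : Function.Bijective (t u).2 ↔ Function.Bijective u.2 := by
      rw [e', Function.Bijective.of_comp_iff' L₂.bijective,
        Function.Bijective.of_comp_iff _ L₁.symm.bijective]
    rw [← hbij]
    constructor
    · rintro ⟨f, hf⟩
      rw [← hf]
      exact f.bijective
    · intro h
      exact ⟨(LinearEquiv.ofBijective ((t u).2 : MSpace d →ₗ[ℝ] MSpace d)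
        h).toContinuousLinearEquiv, by ext v : 1; rfl⟩
  refine Filter.mem_of_superset (hO.mem_nhds ⟨?_, ?_⟩) fun u hu => (key u hu.1).1 hu.2
  · exact FiberBundle.mem_trivializationAt_proj_source
  · exact (key u₀ FiberBundle.mem_trivializationAt_proj_source).2 hu₀

/-- The open set of fibrewise invertible linear maps `ℝ^(d+1) → T_x M`. -/
def frameOpens : TopologicalSpace.Opens (TangentHom d M) :=
  ⟨{u | Function.Bijective u.2}, isOpen_frames d M⟩

/-- The bundle `L(M)` of linear frames: a frame at `x` is a linear isomorphism
`u : ℝ^(d+1) → T_x M`, i.e. the ordered basis `e_a = u(stdVec a)` of `T_x M`. It carries the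
topology and the smooth structure of an open subset of the total space of a vector bundle. -/
abbrev FrameBundle : Type _ := frameOpens d M

/-- The model with corners of the frame bundle. -/
abbrev frameModel : ModelWithCorners ℝ (MSpace d × (MSpace d →L[ℝ] MSpace d))
    (ModelProd (MSpace d) (MSpace d →L[ℝ] MSpace d)) :=
  𝓘(ℝ, MSpace d).prod 𝓘(ℝ, MSpace d →L[ℝ] MSpace d)

variable {d M}

namespace FrameBundle

/-- The bundle projection `π : L(M) → M`. -/
def proj (u : FrameBundle d M) : M := u.1.1

/-- The frame `u`, as a linear map `ℝ^(d+1) → T_x M`. -/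
def toHom (u : FrameBundle d M) : MSpace d →L[ℝ] TangentSpace 𝓘(ℝ, MSpace d) u.proj := u.1.2

/-- The `a`-th vector `e_a` of the frame `u`. -/
def vec (u : FrameBundle d M) (a : Fin (d + 1)) : TangentSpace 𝓘(ℝ, MSpace d) u.proj :=
  u.toHom (stdVec d a)

/-- The frame `u`, as an ordered basis of the tangent space. -/
def basis (u : FrameBundle d M) :
    Module.Basis (Fin (d + 1)) ℝ (TangentSpace 𝓘(ℝ, MSpace d) u.proj) :=
  (EuclideanSpace.basisFun (Fin (d + 1)) ℝ).toBasis.map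
    (LinearEquiv.ofBijective (u.toHom : MSpace d →ₗ[ℝ] TangentSpace 𝓘(ℝ, MSpace d) u.proj) u.2)

/-- The right action of `GL(d+1, ℝ)` on the frame bundle: `(u · A) = u ∘ A`, so that the `j`-th
vector of `u · A` is `∑ i, A_ij e_i`. -/
def act (u : FrameBundle d M) (A : GLGroup d) : FrameBundle d M :=
  ⟨⟨u.proj, u.toHom ∘L A.val⟩, by
    have hA : Function.Bijective A.val := (ContinuousLinearEquiv.ofUnit A).bijective
    exact (show Function.Bijective u.toHom from u.2).comp hA⟩

theorem act_one (u : FrameBundle d M) : u.act 1 = u := rfl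

theorem act_act (u : FrameBundle d M) (A B : GLGroup d) : (u.act A).act B = u.act (A * B) := rfl

end FrameBundle

/-- Two frames are equivalent if they differ by an element of the subgroup `H`. -/
def frameSetoid (d : ℕ) (M : Type*) [TopologicalSpace M] [ChartedSpace (MSpace d) M]
    [IsManifold 𝓘(ℝ, MSpace d) ∞ M] (H : Subgroup (GLGroup d)) : Setoid (FrameBundle d M) where
  r u v := ∃ A ∈ H, v = u.act A
  iseqv :=
    { refl := fun u => ⟨1, one_mem _, (u.act_one).symm⟩
      symm := by
        rintro u v ⟨A, hA, rfl⟩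
        exact ⟨A⁻¹, inv_mem hA, by rw [FrameBundle.act_act, mul_inv_cancel, FrameBundle.act_one]⟩
      trans := by
        rintro u v w ⟨A, hA, rfl⟩ ⟨B, hB, rfl⟩
        exact ⟨A * B, mul_mem hA hB, by rw [FrameBundle.act_act]⟩ }

/-- The quotient `L(M)/H`. -/
def FrameQuot (d : ℕ) (M : Type*) [TopologicalSpace M] [ChartedSpace (MSpace d) M]
    [IsManifold 𝓘(ℝ, MSpace d) ∞ M] (H : Subgroup (GLGroup d)) : Type _ :=
  Quotient (frameSetoid d M H)

/-- `L(M)/H` carries the quotient topology. -/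
instance (H : Subgroup (GLGroup d)) : TopologicalSpace (FrameQuot d M H) :=
  inferInstanceAs (TopologicalSpace (Quotient (frameSetoid d M H)))

namespace FrameQuot

/-- The projection `pr : L(M) → L(M)/H`. -/
def pr (H : Subgroup (GLGroup d)) (u : FrameBundle d M) : FrameQuot d M H :=
  Quotient.mk (frameSetoid d M H) u

/-- The projection `L(M)/H → M` of the associated bundle. -/
def proj {H : Subgroup (GLGroup d)} (q : FrameQuot d M H) : M :=
  Quotient.lift (s := frameSetoid d M H) (fun u : FrameBundle d M => u.proj)
    (by rintro u v ⟨A, -, rfl⟩; rfl) q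

end FrameQuot

end FrameBundle

/-! ### Submanifolds, submersions and reductions -/

/-- `S` is an embedded smooth submanifold of the manifold `N`: around each of its points there is a
chart of the smooth structure of `N` which maps `S` onto a slice given by a linear subspace `W` of
the model space. -/
def IsEmbeddedSubmanifold {F : Type*} [NormedAddCommGroup F] [NormedSpace ℝ F]
    {K : Type*} [TopologicalSpace K] (I : ModelWithCorners ℝ F K)
    {N : Type*} [TopologicalSpace N] [ChartedSpace K N] (S : Set N) : Prop :=
  ∃ W : Submodule ℝ F, ∀ p ∈ S, ∃ φ ∈ IsManifold.maximalAtlas I ∞ N, p ∈ φ.source ∧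
    ∀ q ∈ φ.source, q ∈ S ↔ I (φ q) ∈ W

/-- A smooth map between (finite-dimensional) manifolds is a submersion if its differential is
surjective at every point. -/
def IsSmoothSubmersion {F F' : Type*} [NormedAddCommGroup F] [NormedSpace ℝ F]
    [NormedAddCommGroup F'] [NormedSpace ℝ F']
    {K K' : Type*} [TopologicalSpace K] [TopologicalSpace K']
    (I : ModelWithCorners ℝ F K) (I' : ModelWithCorners ℝ F' K')
    {N N' : Type*} [TopologicalSpace N] [ChartedSpace K N] [TopologicalSpace N']
    [ChartedSpace K' N'] (f : N → N') : Prop :=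
  ContMDiff I I' ∞ f ∧ ∀ p, Function.Surjective (mfderiv I I' f p)

section Reduction

variable {d : ℕ} {M : Type*} [TopologicalSpace M] [ChartedSpace (MSpace d) M]
  [IsManifold 𝓘(ℝ, MSpace d) ∞ M]

/-- `Q ⊆ L(M)` is a reduced subbundle with structure group `H ⊆ GL(d+1, ℝ)`: `H` is a Lie subgroup,
`Q` is a submanifold which is stable under the right action of `H`, and `Q → M` is a principal
`H`-bundle: over a neighbourhood `U` of each point of `M` there is a smooth, `GL(d+1, ℝ)`-equivariant
local trivialization `π⁻¹(U) ≃ U × GL(d+1, ℝ)` of `L(M)` which maps `Q ∩ π⁻¹(U)` onto `U × H`. -/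
structure IsReducedSubbundle (Q : Set (FrameBundle d M)) (H : Subgroup (GLGroup d)) : Prop where
  lieSubgroup : IsEmbeddedSubmanifold 𝓘(ℝ, MSpace d →L[ℝ] MSpace d) (H : Set (GLGroup d))
  submanifold : IsEmbeddedSubmanifold (frameModel d) Q
  act_mem : ∀ u ∈ Q, ∀ A ∈ H, u.act A ∈ Q
  locally_trivial : ∀ x : M, ∃ U : Set M, IsOpen U ∧ x ∈ U ∧
    ∃ Φ : PartialDiffeomorph (frameModel d)
        (𝓘(ℝ, MSpace d).prod 𝓘(ℝ, MSpace d →L[ℝ] MSpace d)) (FrameBundle d M) (M × GLGroup d) ∞,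
      Φ.source = FrameBundle.proj ⁻¹' U ∧ Φ.target = U ×ˢ univ ∧
      ∀ u ∈ Φ.source, (Φ u).1 = u.proj ∧
        (∀ A : GLGroup d, (Φ (u.act A)).2 = (Φ u).2 * A) ∧
        (u ∈ Q ↔ (Φ u).2 ∈ H)

/-- A charted space structure on `L(M)/H` (modelled on some `ℝ^m`) is the quotient smooth structure
if it is a smooth manifold structure for which the projection `L(M) → L(M)/H` is a submersion. -/
def IsQuotientSmoothStructure (M : Type*) [TopologicalSpace M] [ChartedSpace (MSpace d) M]
    [IsManifold 𝓘(ℝ, MSpace d) ∞ M] (H : Subgroup (GLGroup d)) {m : ℕ}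
    (cs : ChartedSpace (EuclideanSpace ℝ (Fin m)) (FrameQuot d M H)) : Prop :=
  letI := cs
  IsManifold 𝓘(ℝ, EuclideanSpace ℝ (Fin m)) ∞ (FrameQuot d M H) ∧
    IsSmoothSubmersion (frameModel d) 𝓘(ℝ, EuclideanSpace ℝ (Fin m))
      (FrameQuot.pr H : FrameBundle d M → FrameQuot d M H)

/-- The quotient `L(M)/H` is a (Hausdorff) smooth manifold, with a smooth structure for which
`L(M) → L(M)/H` is a submersion. -/
def QuotientIsManifold (M : Type*) [TopologicalSpace M] [ChartedSpace (MSpace d) M]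
    [IsManifold 𝓘(ℝ, MSpace d) ∞ M] (H : Subgroup (GLGroup d)) : Prop :=
  T2Space (FrameQuot d M H) ∧
    ∃ (m : ℕ) (cs : ChartedSpace (EuclideanSpace ℝ (Fin m)) (FrameQuot d M H)),
      IsQuotientSmoothStructure M H cs

/-- A map `s : M → L(M)/H` is smooth for the quotient smooth structure on `L(M)/H`. -/
def IsSmoothToQuotient {H : Subgroup (GLGroup d)} (s : M → FrameQuot d M H) : Prop :=
  ∀ (m : ℕ) (cs : ChartedSpace (EuclideanSpace ℝ (Fin m)) (FrameQuot d M H)),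
    IsQuotientSmoothStructure M H cs →
      letI := cs
      ContMDiff 𝓘(ℝ, MSpace d) 𝓘(ℝ, EuclideanSpace ℝ (Fin m)) ∞ s

end Reduction

/-! ### Lorentzian metrics, orientations and orthonormal frames -/

section Lorentz

variable (d : ℕ) (M : Type*) [TopologicalSpace M] [ChartedSpace (MSpace d) M]
  [IsManifold 𝓘(ℝ, MSpace d) ∞ M]

/-- A smooth Lorentzian metric on `M`, of signature `(-, +, …, +)`: each tangent space contains a
timelike vector on whose orthogonal complement the metric is positive definite. -/
structure LorentzMetric where
  /-- The metric at each point, as a bilinear form. -/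
  val (x : M) : TangentSpace 𝓘(ℝ, MSpace d) x →L[ℝ] TangentSpace 𝓘(ℝ, MSpace d) x →L[ℝ] ℝ
  symm (x : M) (v w : TangentSpace 𝓘(ℝ, MSpace d) x) : val x v w = val x w v
  signature (x : M) : ∃ v : TangentSpace 𝓘(ℝ, MSpace d) x, val x v v < 0 ∧
    ∀ w : TangentSpace 𝓘(ℝ, MSpace d) x, w ≠ 0 → val x v w = 0 → 0 < val x w w
  contMDiff : ContMDiff 𝓘(ℝ, MSpace d)
    (𝓘(ℝ, MSpace d).prod 𝓘(ℝ, MSpace d →L[ℝ] MSpace d →L[ℝ] ℝ)) ∞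
    (fun x => TotalSpace.mk' (MSpace d →L[ℝ] MSpace d →L[ℝ] ℝ)
      (E := fun x : M => TangentSpace 𝓘(ℝ, MSpace d) x →L[ℝ]
        TangentSpace 𝓘(ℝ, MSpace d) x →L[ℝ] ℝ) x (val x))

/-- An orientation of `M`: an orientation of each tangent space, such that every point has a
neighbourhood with a continuous positively oriented frame field. -/
structure ManifoldOrientation where
  /-- The orientation of each tangent space. -/
  val (x : M) : Orientation ℝ (TangentSpace 𝓘(ℝ, MSpace d) x) (Fin (d + 1))
  continuous (x : M) : ∃ U : Set M, IsOpen U ∧ x ∈ U ∧ ∃ σ : U → FrameBundle d M,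
    Continuous σ ∧ ∀ y : U, (σ y).proj = y ∧ (σ y).basis.orientation = val (σ y).proj

variable {d M}

/-- A time orientation of `(M, g)`: a choice of one of the two cones of timelike vectors in each
tangent space, such that every point has a neighbourhood with a continuous vector field with values
in the chosen cones. -/
structure TimeOrientation (g : LorentzMetric d M) where
  /-- The chosen cone of future pointing timelike vectors. -/
  future (x : M) : Set (TangentSpace 𝓘(ℝ, MSpace d) x)
  isCone (x : M) : ∃ v, g.val x v v < 0 ∧ future x = {w | g.val x w w < 0 ∧ g.val x v w < 0}
  continuous (x : M) : ∃ U : Set M, IsOpen U ∧ x ∈ U ∧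
    ∃ X : ∀ y : M, TangentSpace 𝓘(ℝ, MSpace d) y,
      ContinuousOn (fun y => (⟨y, X y⟩ : TangentBundle 𝓘(ℝ, MSpace d) M)) U ∧
      ∀ y ∈ U, X y ∈ future y

/-- The set of pseudo-orthonormal frames of `g`: `g(e_a, e_b) = η_ab`. -/
def LorentzMetric.orthonormalFrames (g : LorentzMetric d M) : Set (FrameBundle d M) :=
  {u | ∀ a b, g.val u.proj (u.vec a) (u.vec b) = minkowski (stdVec d a) (stdVec d b)}

/-- The set of positively oriented pseudo-orthonormal frames of `g` with future pointing timelike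
vector `e_0`. -/
def LorentzMetric.orientedFrames (g : LorentzMetric d M) (o : ManifoldOrientation d M)
    (τ : TimeOrientation g) : Set (FrameBundle d M) :=
  {u | u ∈ g.orthonormalFrames ∧ u.basis.orientation = o.val u.proj ∧ u.vec 0 ∈ τ.future u.proj}

/-- `Q` is a reduced subbundle of `L(M)` with structure group `H`; the quotient `L(M)/H` is a
smooth manifold; the projection `L(M) → L(M)/H` is constant on the fibres of `Q`, the map
`s : M → L(M)/H` which it induces is a smooth global cross section, and `Q` is the set of frames
whose class is a value of `s`. -/
def ReducesWithSection (Q : Set (FrameBundle d M)) (H : Subgroup (GLGroup d)) : Prop :=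
  IsReducedSubbundle Q H ∧ QuotientIsManifold M H ∧
    ∃! s : M → FrameQuot d M H,
      (∀ u ∈ Q, s u.proj = FrameQuot.pr H u) ∧
      (∀ x, (s x).proj = x) ∧
      IsSmoothToQuotient s ∧
      Q = {u | FrameQuot.pr H u ∈ range s}

end Lorentz

end

/-! Write X* for the adjoint of an endomorphism X of ℝ^(d+1) with respect to η, so that A is a
Lorentz transformation exactly when A A* = 1. The local analysis rests on one map, `lorentzSlice`: A
↦ ½(A A* − 1) + ½(A − A*). Its first summand is self-adjoint, its second is skew, and its derivative
at 1 is the identity. It is therefore a chart near 1 in which O(1,d) becomes the subspace of skew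
operators. Translating it gives slice charts for every subgroup H that is open in O(1,d)
(`IsOpenLorentzSubgroup.exists_chart`). Inverting it on self-adjoint operators gives a smooth square
root κ near 1, with κ(S) κ(S)* = S (`exists_lorentz_sqrt`).

The square root is used twice. For the quotient: A A* determines the coset A·O(1,d)
(`mul_lorentzAdj_eq_iff`), so the base point and A A* are local coordinates on L(M)/O(1,d), with κ
as section; for an open subgroup H the same section singles out one sheet over these coordinates
(`exists_quotientSlice`). For the frames: κ of the inverse Gram operator of g corrects a frame that
is pseudo-orthonormal at one point to a smooth pseudo-orthonormal field nearby
(`exists_orthonormal_section`).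

Smooth local sections of Q and simple transitivity of H on its fibres (`HasSmoothReduction`) imply
the rest formally. Moving the section to the identity turns Q into U × H, and s(x) is the class of
any frame of Q at x.

For the oriented case, L₊^↑ is open in O(1,d), because the determinant takes only the values ±1
there. Having the right orientation and time orientation is an open condition along a continuous
pseudo-orthonormal frame field. A frame with the right signs at a given point comes from −1 and from
the reflection of a space axis, which exists because d ≥ 1. -/

noncomputable section

/-! ### The adjoint with respect to the Minkowski form -/

section Adjoint

variable {d : ℕ}

/-- The reflection of the time coordinate. -/
def timeReflection (d : ℕ) : MSpace d →L[ℝ] MSpace d :=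
  LinearMap.toContinuousLinearMap
    { toFun := fun v => WithLp.toLp 2 (Fin.cons (-(v 0)) fun i => v i.succ)
      map_add' := by
        intro v w; ext i; refine Fin.cases ?_ (fun i => ?_) i <;> simp [add_comm]
      map_smul' := by
        intro c v; ext i; refine Fin.cases ?_ (fun i => ?_) i <;> simp }

@[simp] theorem timeReflection_zero (v : MSpace d) : timeReflection d v 0 = -(v 0) := rfl

@[simp] theorem timeReflection_succ (v : MSpace d) (i : Fin d) :
    timeReflection d v i.succ = v i.succ := rfl

@[simp] theorem timeReflection_timeReflection (v : MSpace d) :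
    timeReflection d (timeReflection d v) = v := by
  ext i; refine Fin.cases ?_ (fun i => ?_) i <;> simp

theorem minkowski_eq_inner (v w : MSpace d) :
    minkowski v w = inner ℝ (timeReflection d v) w := by
  simp [minkowski, PiLp.inner_apply, Fin.sum_univ_succ, mul_comm]

theorem minkowski_comm (v w : MSpace d) : minkowski v w = minkowski w v := by
  simp [minkowski, mul_comm]

/-- This is nondegeneracy of η: testing against reflected vectors turns η into the Euclidean inner
product. -/
theorem minkowski_right_injective {v v' : MSpace d}
    (h : ∀ w, minkowski w v = minkowski w v') : v = v' := by
  refine ext_inner_left ℝ fun w => ?_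
  simpa [minkowski_eq_inner] using h (timeReflection d w)

/-- The adjoint of an endomorphism of `ℝ^(d+1)` with respect to the Minkowski form. -/
def lorentzAdj (d : ℕ) : (MSpace d →L[ℝ] MSpace d) →L[ℝ] (MSpace d →L[ℝ] MSpace d) :=
  LinearMap.toContinuousLinearMap
    { toFun := fun A => timeReflection d ∘L ContinuousLinearMap.adjoint A ∘L timeReflection d
      map_add' := by intro A B; ext v : 1; simp
      map_smul' := by intro c A; ext v : 1; simp }

/-- The time reflection θ is a Euclidean self-adjoint involution and η(v, w) = ⟨θv, w⟩, so
conjugating the Euclidean adjoint by θ gives the adjoint for η. -/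
theorem minkowski_lorentzAdj (A : MSpace d →L[ℝ] MSpace d) (v w : MSpace d) :
    minkowski v (lorentzAdj d A w) = minkowski (A v) w := by
  have h : ∀ v w : MSpace d, inner ℝ (timeReflection d v) w = inner ℝ v (timeReflection d w) := by
    intro v w
    simp [PiLp.inner_apply, Fin.sum_univ_succ]
  have e : lorentzAdj d A w =
    timeReflection d (ContinuousLinearMap.adjoint A (timeReflection d w)) := rfl
  rw [minkowski_eq_inner, minkowski_eq_inner, e, h, timeReflection_timeReflection,
    ContinuousLinearMap.adjoint_inner_right, h]

theorem minkowski_lorentzAdj_left (A : MSpace d →L[ℝ] MSpace d) (v w : MSpace d) :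
    minkowski (lorentzAdj d A v) w = minkowski v (A w) := by
  rw [minkowski_comm, minkowski_lorentzAdj, minkowski_comm]

/-- Uniqueness of adjoints. The algebraic rules for `lorentzAdj` are deduced from this. -/
theorem eq_of_minkowski {A B : MSpace d →L[ℝ] MSpace d}
    (h : ∀ v w, minkowski v (A w) = minkowski v (B w)) : A = B := by
  ext w : 1
  exact minkowski_right_injective fun v => h v w

@[simp] theorem lorentzAdj_lorentzAdj (A : MSpace d →L[ℝ] MSpace d) :
    lorentzAdj d (lorentzAdj d A) = A :=
  eq_of_minkowski fun v w => by rw [minkowski_lorentzAdj, minkowski_lorentzAdj_left]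

@[simp] theorem lorentzAdj_one : lorentzAdj d 1 = 1 :=
  eq_of_minkowski fun v w => by rw [minkowski_lorentzAdj]; rfl

@[simp] theorem lorentzAdj_mul (A B : MSpace d →L[ℝ] MSpace d) :
    lorentzAdj d (A * B) = lorentzAdj d B * lorentzAdj d A :=
  eq_of_minkowski fun v w => by
    rw [minkowski_lorentzAdj, mul_apply_eq_comp, mul_apply_eq_comp, minkowski_lorentzAdj,
      minkowski_lorentzAdj]

theorem mem_lorentzGroup_iff {A : GLGroup d} :
    A ∈ lorentzGroup d ↔ lorentzAdj d A.val * A.val = 1 := by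
  constructor
  · intro h
    refine eq_of_minkowski fun v w => ?_
    rw [mul_apply_eq_comp, minkowski_lorentzAdj]
    exact h v w
  · intro h v w
    rw [← minkowski_lorentzAdj, ← mul_apply_eq_comp, h]
    rfl

/-- One-sided inverses of units are two-sided. The order A A* is the one compatible with left
cosets, hence with the right action on frames. -/
theorem mem_lorentzGroup_iff' {A : GLGroup d} :
    A ∈ lorentzGroup d ↔ A.val * lorentzAdj d A.val = 1 := by
  rw [mem_lorentzGroup_iff, Units.mul_eq_one_iff_inv_eq, Units.mul_eq_one_iff_eq_inv, eq_comm]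

/-- The skew endomorphisms for the Minkowski form: the Lie algebra of the Lorentz group. -/
def lorentzSkew (d : ℕ) : Submodule ℝ (MSpace d →L[ℝ] MSpace d) :=
  LinearMap.ker ((lorentzAdj d : _ →ₗ[ℝ] _) + LinearMap.id)

theorem mem_lorentzSkew {A : MSpace d →L[ℝ] MSpace d} :
    A ∈ lorentzSkew d ↔ lorentzAdj d A = -A := by
  simp [lorentzSkew, LinearMap.mem_ker, eq_neg_iff_add_eq_zero]

/-- The self-adjoint endomorphisms for the Minkowski form. -/
def lorentzSym (d : ℕ) : Submodule ℝ (MSpace d →L[ℝ] MSpace d) :=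
  LinearMap.ker ((lorentzAdj d : _ →ₗ[ℝ] _) - LinearMap.id)

theorem mem_lorentzSym {A : MSpace d →L[ℝ] MSpace d} :
    A ∈ lorentzSym d ↔ lorentzAdj d A = A := by
  simp [lorentzSym, LinearMap.mem_ker, sub_eq_zero]

theorem mul_lorentzAdj_mem_lorentzSym (A : MSpace d →L[ℝ] MSpace d) :
    A * lorentzAdj d A ∈ lorentzSym d := by
  simp [mem_lorentzSym]

end Adjoint

/-! ### A slice chart for the Lorentz group -/

/-- The inverse function theorem for smooth maps, with a smooth inverse on an open set. -/
theorem ContDiff.exists_openPartialHomeomorph {E : Type*} [NormedAddCommGroup E] [NormedSpace ℝ E]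
    [CompleteSpace E] {f : E → E} (hf : ContDiff ℝ ∞ f) {a : E} {f' : E ≃L[ℝ] E}
    (hf' : HasFDerivAt f (f' : E →L[ℝ] E) a) {s : Set E} (hs : IsOpen s) (ha : a ∈ s) :
    ∃ e : OpenPartialHomeomorph E E, a ∈ e.source ∧ e.source ⊆ s ∧ ⇑e = f ∧
      ContDiffOn ℝ ∞ e.symm e.target := by
  have hn : (∞ : WithTop ℕ∞) ≠ 0 := by simp
  let e₀ := hf.contDiffAt.toOpenPartialHomeomorph f hf' hn
  -- Shrinking to the points where the derivative is invertible makes the inverse smooth on the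
  -- whole target, not only near the image of `a`.
  have hU : IsOpen (fderiv ℝ f ⁻¹' range ((↑) : (E ≃L[ℝ] E) → E →L[ℝ] E)) :=
    ContinuousLinearEquiv.isOpen.preimage (hf.continuous_fderiv hn)
  have hV := hU.inter hs
  refine ⟨e₀.restrOpen _ hV, ?_, ?_, rfl, ?_⟩
  · rw [e₀.restrOpen_source]
    refine ⟨hf.contDiffAt.mem_toOpenPartialHomeomorph_source hf' hn, ?_, ha⟩
    rw [mem_preimage, hf'.fderiv]
    exact mem_range_self f'
  · rw [e₀.restrOpen_source]
    exact fun x hx => hx.2.2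
  · intro y hy
    have hy' := (e₀.restrOpen _ hV).map_target hy
    rw [e₀.restrOpen_source] at hy'
    obtain ⟨g, hg⟩ := hy'.2.1
    refine ContDiffAt.contDiffWithinAt
      (OpenPartialHomeomorph.contDiffAt_symm (f₀' := g) _ hy ?_ hf.contDiffAt)
    rw [hg]
    exact (hf.differentiable hn _).hasFDerivAt

section SliceChart

variable {d : ℕ}

/-- A map of endomorphisms whose self-adjoint part vanishes exactly on the Lorentz group. -/
def lorentzSlice (d : ℕ) (A : MSpace d →L[ℝ] MSpace d) : MSpace d →L[ℝ] MSpace d :=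
  (2⁻¹ : ℝ) • (A * lorentzAdj d A - 1) + (2⁻¹ : ℝ) • (A - lorentzAdj d A)

theorem contDiff_lorentzSlice : ContDiff ℝ ∞ (lorentzSlice d) := by
  unfold lorentzSlice
  have h : ContDiff ℝ ∞ (lorentzAdj d) := (lorentzAdj d).contDiff
  fun_prop

/-- Since L 1 = 1, the product A · L A has derivative X + L X at 1, and ½(X + L X) + ½(X − L X) = X.
-/
theorem hasFDerivAt_mul_involution_slice {R : Type*} [NormedRing R] [NormedAlgebra ℝ R]
    (L : R →L[ℝ] R) (hL : L 1 = 1) :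
    HasFDerivAt (fun A => (2⁻¹ : ℝ) • (A * L A - 1) + (2⁻¹ : ℝ) • (A - L A))
      (ContinuousLinearMap.id ℝ R) 1 := by
  have h : HasFDerivAt L L 1 := L.hasFDerivAt
  have h1 := (((hasFDerivAt_id (𝕜 := ℝ) (1 : R)).mul' h).sub_const 1).const_smul (2⁻¹ : ℝ)
  have h2 := ((hasFDerivAt_id (𝕜 := ℝ) (1 : R)).sub h).const_smul (2⁻¹ : ℝ)
  refine (h1.add h2).congr_fderiv ?_
  ext X
  simp only [id_eq, hL, one_smul, add_apply, smul_apply, sub_apply, ContinuousLinearMap.id_apply,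
    MulOpposite.op_one]
  module

theorem hasFDerivAt_lorentzSlice : HasFDerivAt (lorentzSlice d)
    ((ContinuousLinearEquiv.refl ℝ (MSpace d →L[ℝ] MSpace d) :
      (MSpace d →L[ℝ] MSpace d) ≃L[ℝ] (MSpace d →L[ℝ] MSpace d)) :
      (MSpace d →L[ℝ] MSpace d) →L[ℝ] (MSpace d →L[ℝ] MSpace d)) 1 :=
  hasFDerivAt_mul_involution_slice (lorentzAdj d) lorentzAdj_one

@[simp] theorem lorentzSlice_one : lorentzSlice d 1 = 0 := by simp [lorentzSlice]

/-- Adding the adjoint cancels the skew summand and doubles the self-adjoint one. -/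
theorem lorentzAdj_lorentzSlice_add (A : MSpace d →L[ℝ] MSpace d) :
    lorentzAdj d (lorentzSlice d A) + lorentzSlice d A = A * lorentzAdj d A - 1 := by
  simp only [lorentzSlice, map_add, map_smul, map_sub, lorentzAdj_mul, lorentzAdj_lorentzAdj,
    lorentzAdj_one]
  module

theorem lorentzSlice_mem_lorentzSkew_iff {A : MSpace d →L[ℝ] MSpace d} :
    lorentzSlice d A ∈ lorentzSkew d ↔ A * lorentzAdj d A = 1 := by
  rw [mem_lorentzSkew, eq_neg_iff_add_eq_zero, lorentzAdj_lorentzSlice_add, sub_eq_zero]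

/-- The map `lorentzSlice` is a local diffeomorphism around the identity. -/
theorem exists_lorentzSlice_chart (d : ℕ) :
    ∃ e : OpenPartialHomeomorph (MSpace d →L[ℝ] MSpace d) (MSpace d →L[ℝ] MSpace d),
      1 ∈ e.source ∧ e.source ⊆ {A | IsUnit A} ∧ ⇑e = lorentzSlice d ∧
      ContDiffOn ℝ ∞ e.symm e.target :=
  contDiff_lorentzSlice.exists_openPartialHomeomorph hasFDerivAt_lorentzSlice Units.isOpen
    isUnit_one

/-- Self-adjoint endomorphisms `S` close to the identity are smoothly of the form `A A^*`. -/
theorem exists_lorentz_sqrt (d : ℕ) :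
    ∃ (T : Set (MSpace d →L[ℝ] MSpace d))
      (κ : (MSpace d →L[ℝ] MSpace d) → (MSpace d →L[ℝ] MSpace d)),
      IsOpen T ∧ 1 ∈ T ∧ ContDiffOn ℝ ∞ κ T ∧ κ 1 = 1 ∧ (∀ S ∈ T, IsUnit (κ S)) ∧
      ∀ S ∈ T, S ∈ lorentzSym d → κ S * lorentzAdj d (κ S) = S := by
  obtain ⟨e, h1, hu, he, hs⟩ := exists_lorentzSlice_chart d
  -- κ(S) is the point of the slice chart with value ½(S − 1). For self-adjoint S, adding this value
  -- to its adjoint gives S − 1, which must equal κ(S) κ(S)* − 1.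
  have hc : ContDiff ℝ ∞ (fun S : MSpace d →L[ℝ] MSpace d => (2⁻¹ : ℝ) • (S - 1)) := by fun_prop
  refine ⟨(fun S => (2⁻¹ : ℝ) • (S - 1)) ⁻¹' e.target, fun S => e.symm ((2⁻¹ : ℝ) • (S - 1)),
    e.open_target.preimage hc.continuous, ?_, hs.comp hc.contDiffOn fun S hS => hS, ?_, ?_, ?_⟩
  · have := e.map_source h1
    rw [he, lorentzSlice_one] at this
    simpa using this
  · have := e.left_inv h1
    rw [he, lorentzSlice_one] at this
    simpa using this
  · exact fun S hS => hu (e.map_target hS)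
  · intro S hS hS'
    have h := e.right_inv hS
    rw [he] at h
    have h' := lorentzAdj_lorentzSlice_add (e.symm ((2⁻¹ : ℝ) • (S - 1)))
    rw [h, map_smul, map_sub, lorentzAdj_one, mem_lorentzSym.1 hS'] at h'
    have : S - 1 = e.symm ((2⁻¹ : ℝ) • (S - 1)) * lorentzAdj d (e.symm ((2⁻¹ : ℝ) • (S - 1))) - 1 := by
      rw [← h']; module
    exact (sub_left_injective this).symm

end SliceChart

/-! ### Smooth maps into the group of units -/

section UnitsMaps

/-- A map with values in the units of a monoid, extended by `1` where `f` is no unit. -/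
def unitsLift {N R : Type*} [Monoid R] (f : N → R) (x : N) : Rˣ :=
  open Classical in if h : IsUnit (f x) then h.unit else 1

theorem unitsLift_val {N R : Type*} [Monoid R] {f : N → R} {x : N} (h : IsUnit (f x)) :
    (unitsLift f x : R) = f x := by
  simp [unitsLift, h]

variable {R : Type*} [NormedRing R] [CompleteSpace R] [NormedAlgebra ℝ R]
  {F : Type*} [NormedAddCommGroup F] [NormedSpace ℝ F]
  {K : Type*} [TopologicalSpace K] {I : ModelWithCorners ℝ F K}
  {N : Type*} [TopologicalSpace N] [ChartedSpace K N] {n : WithTop ℕ∞}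

/-- The smooth structure on the units comes from their open embedding into R, whose local inverse is
smooth. -/
theorem contMDiffOn_units_iff {f : N → Rˣ} {s : Set N} :
    ContMDiffOn I 𝓘(ℝ, R) n f s ↔ ContMDiffOn I 𝓘(ℝ, R) n (fun x => (f x : R)) s := by
  constructor
  · exact fun h => Units.contMDiff_val.comp_contMDiffOn h
  · intro h
    have h1 := (contMDiffOn_isOpenEmbedding_symm (I := 𝓘(ℝ, R)) (n := n)
      (Units.isOpenEmbedding_val (R := R))).comp h (fun x _ => mem_range_self (f x))
    refine h1.congr fun x _ => ?_
    exact (Units.isOpenEmbedding_val.toOpenPartialHomeomorph_left_inv (f := Units.val)).symm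

theorem contMDiffOn_unitsLift {f : N → R} {s : Set N} (hf : ContMDiffOn I 𝓘(ℝ, R) n f s)
    (hs : ∀ x ∈ s, IsUnit (f x)) : ContMDiffOn I 𝓘(ℝ, R) n (unitsLift f) s :=
  contMDiffOn_units_iff.2 (hf.congr fun x hx => unitsLift_val (hs x hx))

end UnitsMaps

/-! ### Open subgroups of the Lorentz group -/

section OpenSubgroups

variable {d : ℕ}

/-- `H` is a subgroup of the Lorentz group which is cut out of it by an open set. -/
def IsOpenLorentzSubgroup (H : Subgroup (GLGroup d)) : Prop :=
  ∃ V : Set (GLGroup d), IsOpen V ∧ ∀ A, A ∈ H ↔ A ∈ lorentzGroup d ∧ A ∈ V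

theorem continuous_lorentzAdj_val : Continuous fun A : GLGroup d => lorentzAdj d A.val :=
  (lorentzAdj d).continuous.comp Units.continuous_val

theorem isClosed_lorentzGroup : IsClosed (lorentzGroup d : Set (GLGroup d)) := by
  have h : (lorentzGroup d : Set (GLGroup d)) = {A | A.val * lorentzAdj d A.val = 1} := by
    ext A; exact mem_lorentzGroup_iff'
  rw [h]
  exact isClosed_eq (Units.continuous_val.mul continuous_lorentzAdj_val) continuous_const

/-- An open subgroup is closed: if B lies in O(1,d) and C ∈ H is close to B, then B⁻¹C lies in
O(1,d) ∩ V = H, so B ∈ H. Away from O(1,d), closedness of the Lorentz group suffices. -/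
theorem IsOpenLorentzSubgroup.isClosed {H : Subgroup (GLGroup d)} (hH : IsOpenLorentzSubgroup H) :
    IsClosed (H : Set (GLGroup d)) := by
  obtain ⟨V, hV, hHV⟩ := hH
  rw [← isOpen_compl_iff, isOpen_iff_mem_nhds]
  intro B hB
  by_cases hBO : B ∈ lorentzGroup d
  · have hc : ContinuousAt (fun C : GLGroup d => B⁻¹ * C) B := by fun_prop
    have h1 : V ∈ 𝓝 (B⁻¹ * B) := by
      rw [inv_mul_cancel]
      exact hV.mem_nhds ((hHV 1).1 (one_mem H)).2
    filter_upwards [hc h1] with C hC hCH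
    have hCO := ((hHV C).1 hCH).1
    have h2 : B⁻¹ * C ∈ H := (hHV _).2 ⟨mul_mem (inv_mem hBO) hCO, hC⟩
    refine hB ?_
    have := mul_mem hCH (inv_mem h2)
    simpa using this
  · filter_upwards [isClosed_lorentzGroup.isOpen_compl.mem_nhds hBO] with C hC hCH
    exact hC ((hHV C).1 hCH).1

theorem contMDiff_mul_left_val (A : GLGroup d) :
    ContMDiff 𝓘(ℝ, MSpace d →L[ℝ] MSpace d) 𝓘(ℝ, MSpace d →L[ℝ] MSpace d) ∞
      fun B : GLGroup d => (A * B).val :=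
  Units.contMDiff_val.comp contMDiff_mul_left

/-- Around each of its points, an open subgroup of the Lorentz group is a slice. -/
theorem IsOpenLorentzSubgroup.exists_chart {H : Subgroup (GLGroup d)}
    (hH : IsOpenLorentzSubgroup H) {A : GLGroup d} (hA : A ∈ H) :
    ∃ φ : OpenPartialHomeomorph (GLGroup d) (MSpace d →L[ℝ] MSpace d),
      ContMDiffOn 𝓘(ℝ, MSpace d →L[ℝ] MSpace d) 𝓘(ℝ, MSpace d →L[ℝ] MSpace d) ∞ φ φ.source ∧
      ContMDiffOn 𝓘(ℝ, MSpace d →L[ℝ] MSpace d) 𝓘(ℝ, MSpace d →L[ℝ] MSpace d) ∞ φ.symm φ.target ∧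
      A ∈ φ.source ∧ ∀ B ∈ φ.source, B ∈ H ↔ φ B ∈ lorentzSkew d := by
  obtain ⟨V, hV, hHV⟩ := hH
  obtain ⟨e, h1, hu, he, hs⟩ := exists_lorentzSlice_chart d
  -- Left translation by A⁻¹ moves A to 1, where the slice chart lives.
  let c : OpenPartialHomeomorph (GLGroup d) (MSpace d →L[ℝ] MSpace d) :=
    (Homeomorph.mulLeft A⁻¹).toOpenPartialHomeomorph.trans
      (Units.isOpenEmbedding_val.toOpenPartialHomeomorph Units.val)
  have hc : ∀ B, c B = (A⁻¹ * B).val := fun B => rfl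
  have hcs : c.source = univ := by simp [c]
  have hct : c.target = {X | IsUnit X} := by
    ext X
    simp [c, IsUnit]
  have hcsm : ContMDiff 𝓘(ℝ, MSpace d →L[ℝ] MSpace d) 𝓘(ℝ, MSpace d →L[ℝ] MSpace d) ∞ c :=
    contMDiff_mul_left_val A⁻¹
  have hcsm' : ContMDiffOn 𝓘(ℝ, MSpace d →L[ℝ] MSpace d) 𝓘(ℝ, MSpace d →L[ℝ] MSpace d) ∞ c.symm
      c.target := by
    have h2 := (contMDiff_mul_left (I := 𝓘(ℝ, MSpace d →L[ℝ] MSpace d)) (n := ∞)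
      (a := A)).comp_contMDiffOn
      (contMDiffOn_isOpenEmbedding_symm (I := 𝓘(ℝ, MSpace d →L[ℝ] MSpace d)) (n := ∞)
      (Units.isOpenEmbedding_val (R := MSpace d →L[ℝ] MSpace d)))
    refine (h2.mono ?_).congr fun X hX => ?_
    · rw [hct]; exact fun X hX => hX
    · simp [c, Homeomorph.mulLeft_symm]
  -- On this set membership of A⁻¹B in H reduces to membership in the full Lorentz group, which the
  -- slice chart detects.
  have hVA : IsOpen {B : GLGroup d | A⁻¹ * B ∈ V} := hV.preimage (by fun_prop)
  let φ := (c.trans e).restrOpen _ hVA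
  have hφs : ∀ B, B ∈ φ.source ↔ c B ∈ e.source ∧ A⁻¹ * B ∈ V := by
    intro B
    rw [OpenPartialHomeomorph.restrOpen_source, OpenPartialHomeomorph.trans_source, hcs]
    simp
  have hφ : ∀ B, φ B = e (c B) := fun B => rfl
  have hφsymm : ∀ X, φ.symm X = c.symm (e.symm X) := fun B => rfl
  have hφt : ∀ X ∈ φ.target, X ∈ e.target ∧ e.symm X ∈ c.target := by
    intro X hX
    have := φ.map_target hX
    rw [hφs, hφsymm] at this
    have hX' : X ∈ (c.trans e).target := hX.1
    rw [OpenPartialHomeomorph.trans_target] at hX'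
    exact hX'
  refine ⟨φ, ?_, ?_, ?_, ?_⟩
  · have h2 : ContMDiff 𝓘(ℝ, MSpace d →L[ℝ] MSpace d) 𝓘(ℝ, MSpace d →L[ℝ] MSpace d) ∞ e := by
      rw [he]; exact contDiff_lorentzSlice.contMDiff
    exact (h2.comp hcsm).contMDiffOn
  · exact hcsm'.comp (hs.contMDiffOn.mono fun X hX => (hφt X hX).1) fun X hX => (hφt X hX).2
  · rw [hφs, hc, inv_mul_cancel]
    exact ⟨h1, ((hHV 1).1 (one_mem H)).2⟩
  · intro B hB
    rw [hφs] at hB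
    have hAO := ((hHV A).1 hA).1
    rw [hφ, he, lorentzSlice_mem_lorentzSkew_iff, hc, ← mem_lorentzGroup_iff',
      ← Subgroup.mul_mem_cancel_left H (inv_mem hA), hHV]
    exact and_iff_left hB.2

theorem IsOpenLorentzSubgroup.isEmbeddedSubmanifold {H : Subgroup (GLGroup d)}
    (hH : IsOpenLorentzSubgroup H) :
    IsEmbeddedSubmanifold 𝓘(ℝ, MSpace d →L[ℝ] MSpace d) (H : Set (GLGroup d)) := by
  refine ⟨lorentzSkew d, fun A hA => ?_⟩
  obtain ⟨φ, h1, h2, h3, h4⟩ := hH.exists_chart hA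
  exact ⟨φ, φ.mem_maximalAtlas_of_contMDiffOn h1 h2, h3, h4⟩

end OpenSubgroups

/-! ### Quotient manifolds -/

section Quotient

variable {F : Type*} [NormedAddCommGroup F] [NormedSpace ℝ F]
  {K : Type*} [TopologicalSpace K] {I : ModelWithCorners ℝ F K}
  {N : Type*} [TopologicalSpace N] [ChartedSpace K N]
  {Y : Type*} [TopologicalSpace Y]
  {V : Type*} [NormedAddCommGroup V] [NormedSpace ℝ V]

/-- A smooth slice for the map `pr : N → Y`: a smooth map `toFun` on the open saturated set
`source` which separates exactly the fibres of `pr`, with a smooth right inverse `lift` on the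
open set `target`. -/
structure QuotientSlice (I : ModelWithCorners ℝ F K) (V : Type*) [NormedAddCommGroup V]
    [NormedSpace ℝ V] (pr : N → Y) where
  /-- The domain of the slice. -/
  source : Set N
  /-- The codomain of the slice. -/
  target : Set V
  /-- The map that parametrizes the fibres. -/
  toFun : N → V
  /-- A smooth section. -/
  lift : V → N
  open_source : IsOpen source
  open_target : IsOpen target
  map_source : ∀ u ∈ source, toFun u ∈ target
  map_target : ∀ t ∈ target, lift t ∈ source
  right_inv : ∀ t ∈ target, toFun (lift t) = t
  fibre_iff : ∀ u ∈ source, ∀ v, pr u = pr v ↔ v ∈ source ∧ toFun u = toFun v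
  contMDiffOn_toFun : ContMDiffOn I 𝓘(ℝ, V) ∞ toFun source
  contMDiffOn_lift : ContMDiffOn 𝓘(ℝ, V) I ∞ lift target

namespace QuotientSlice

variable {pr : N → Y} (s : QuotientSlice I V pr)

/-- The chart of the quotient given by a slice. -/
def chart (hpr : IsOpenQuotientMap pr) : OpenPartialHomeomorph Y V where
  -- The representative is arbitrary: by `fibre_iff` it stays in the saturated source and the value
  -- does not depend on it.
  toFun q := s.toFun (Function.surjInv hpr.surjective q)
  invFun t := pr (s.lift t)
  source := pr '' s.source
  target := s.target
  map_source' := by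
    rintro _ ⟨u, hu, rfl⟩
    exact s.map_source _ ((s.fibre_iff u hu _).1 (Function.surjInv_eq hpr.surjective _).symm).1
  map_target' t ht := mem_image_of_mem _ (s.map_target t ht)
  left_inv' := by
    rintro _ ⟨u, hu, rfl⟩
    have h := (s.fibre_iff u hu _).1 (Function.surjInv_eq hpr.surjective (pr u)).symm
    have ht := s.map_source _ h.1
    rw [eq_comm, s.fibre_iff u hu]
    exact ⟨s.map_target _ ht, by rw [s.right_inv _ ht, h.2]⟩
  right_inv' t ht := by
    have h := (s.fibre_iff _ (s.map_target t ht) _).1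
      (Function.surjInv_eq hpr.surjective (pr (s.lift t))).symm
    rw [← h.2, s.right_inv t ht]
  open_source := hpr.isOpenMap _ s.open_source
  open_target := s.open_target
  continuousOn_toFun := by
    rintro _ ⟨u, hu, rfl⟩
    -- Continuity is tested after composing with the open quotient map, where the chart becomes
    -- `s.toFun`.
    refine ContinuousAt.continuousWithinAt (hpr.continuousAt_comp_iff.1 ?_)
    have hc := s.contMDiffOn_toFun.continuousOn.continuousAt (s.open_source.mem_nhds hu)
    refine hc.congr ?_
    filter_upwards [s.open_source.mem_nhds hu] with v hv
    exact ((s.fibre_iff v hv _).1 (Function.surjInv_eq hpr.surjective (pr v)).symm).2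
  continuousOn_invFun :=
    hpr.continuous.comp_continuousOn s.contMDiffOn_lift.continuousOn

theorem chart_apply (hpr : IsOpenQuotientMap pr) {u : N} (hu : u ∈ s.source) : s.chart hpr (pr u) = s.toFun u :=
  ((s.fibre_iff u hu _).1 (Function.surjInv_eq hpr.surjective (pr u)).symm).2.symm

theorem mem_chart_source_iff (hpr : IsOpenQuotientMap pr) {u : N} : pr u ∈ (s.chart hpr).source ↔ u ∈ s.source := by
  constructor
  · rintro ⟨v, hv, hvu⟩
    exact ((s.fibre_iff v hv u).1 hvu).1
  · exact fun hu => mem_image_of_mem _ hu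

end QuotientSlice

variable {pr : N → Y}

/-- The charted space structure on a quotient given by a family of slices. -/
abbrev quotientChartedSpace (hpr : IsOpenQuotientMap pr) (s : N → QuotientSlice I V pr)
    (hs : ∀ u, u ∈ (s u).source) : ChartedSpace V Y where
  atlas := range fun u => (s u).chart hpr
  chartAt q := (s (Function.surjInv hpr.surjective q)).chart hpr
  mem_chart_source q := by
    have h := mem_image_of_mem pr (hs (Function.surjInv hpr.surjective q))
    rwa [Function.surjInv_eq hpr.surjective q] at h
  chart_mem_atlas q := mem_range_self _

/-- A change of charts is `toFun` of one slice composed with `lift` of another, hence smooth. -/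
theorem isManifold_quotient (hpr : IsOpenQuotientMap pr) (s : N → QuotientSlice I V pr)
    (hs : ∀ u, u ∈ (s u).source) :
    letI := quotientChartedSpace hpr s hs
    IsManifold 𝓘(ℝ, V) ∞ Y := by
  let := quotientChartedSpace hpr s hs
  refine isManifold_of_contDiffOn _ _ _ ?_
  rintro _ _ ⟨u, rfl⟩ ⟨v, rfl⟩
  simp only [modelWithCornersSelf_coe, modelWithCornersSelf_coe_symm, Function.comp_id,
    Function.id_comp, preimage_id, range_id, inter_univ]
  have hsub : ∀ t ∈ (((s u).chart hpr).symm.trans ((s v).chart hpr)).source,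
      t ∈ (s u).target ∧ (s u).lift t ∈ (s v).source := by
    intro t ht
    rw [OpenPartialHomeomorph.trans_source] at ht
    exact ⟨ht.1, ((s v).mem_chart_source_iff hpr).1 ht.2⟩
  have h := (s v).contMDiffOn_toFun.comp (((s u).contMDiffOn_lift).mono fun t ht => (hsub t ht).1)
    fun t ht => (hsub t ht).2
  rw [contMDiffOn_iff_contDiffOn] at h
  refine h.congr fun t ht => ?_
  exact (s v).chart_apply hpr (hsub t ht).2

/-- Near u, `pr` is the inverse chart after `toFun`, hence smooth. Since `pr ∘ lift` is an inverse
chart, its differential is onto; `hs'` makes `lift` pass through u itself, so the differential of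
`pr` at u is onto. -/
theorem isSmoothSubmersion_quotient (hpr : IsOpenQuotientMap pr) (s : N → QuotientSlice I V pr)
    (hs : ∀ u, u ∈ (s u).source) (hs' : ∀ u, (s u).lift ((s u).toFun u) = u) :
    letI := quotientChartedSpace hpr s hs
    IsSmoothSubmersion I 𝓘(ℝ, V) pr := by
  let := quotientChartedSpace hpr s hs
  have : IsManifold 𝓘(ℝ, V) ∞ Y := isManifold_quotient hpr s hs
  have hsm : ContMDiff I 𝓘(ℝ, V) ∞ pr := by
    intro u
    set w := s u
    have hmem : w.chart hpr ∈ IsManifold.maximalAtlas 𝓘(ℝ, V) ∞ Y :=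
      IsManifold.subset_maximalAtlas (mem_range_self u)
    have hu : u ∈ w.source := hs u
    have h1 : ContMDiffAt 𝓘(ℝ, V) 𝓘(ℝ, V) ∞ (w.chart hpr).symm (w.toFun u) :=
      contMDiffAt_symm_of_mem_maximalAtlas hmem (w.map_source u hu)
    have h2 := h1.comp u (w.contMDiffOn_toFun.contMDiffAt (w.open_source.mem_nhds hu))
    refine h2.congr_of_eventuallyEq ?_
    filter_upwards [w.open_source.mem_nhds hu] with v hv
    rw [Function.comp_apply, ← w.chart_apply hpr hv,
      (w.chart hpr).left_inv ((w.mem_chart_source_iff hpr).2 hv)]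
  refine ⟨hsm, fun u => ?_⟩
  set w := s u
  have hu : u ∈ w.source := hs u
  have ht := w.map_source u hu
  have : IsManifold 𝓘(ℝ, V) 1 Y := IsManifold.of_le (n := ∞) (by simp)
  have hmd : (w.chart hpr).MDifferentiable 𝓘(ℝ, V) 𝓘(ℝ, V) :=
    mdifferentiable_of_mem_atlas (mem_range_self u)
  have hsurj := hmd.symm.mfderiv_surjective (x := w.toFun u) ht
  have hsec : MDifferentiableAt 𝓘(ℝ, V) I w.lift (w.toFun u) :=
    (w.contMDiffOn_lift.contMDiffAt (w.open_target.mem_nhds ht)).mdifferentiableAt (by simp)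
  have hp : MDifferentiableAt I 𝓘(ℝ, V) pr (w.lift (w.toFun u)) :=
    (hsm _).mdifferentiableAt (by simp)
  have hcomp : mfderiv 𝓘(ℝ, V) 𝓘(ℝ, V) (pr ∘ w.lift) (w.toFun u) = _ :=
    mfderiv_comp (f := w.lift) (w.toFun u) hp hsec
  change Function.Surjective (mfderiv 𝓘(ℝ, V) 𝓘(ℝ, V) (pr ∘ w.lift) (w.toFun u)) at hsurj
  rw [hcomp] at hsurj
  have h3 := Function.Surjective.of_comp (f := mfderiv I 𝓘(ℝ, V) pr (w.lift (w.toFun u)))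
    (g := mfderiv 𝓘(ℝ, V) I w.lift (w.toFun u)) hsurj
  rwa [hs' u] at h3

end Quotient

/-! ### Local trivializations of the frame bundle -/

section FrameTrivialization

variable {d : ℕ} {M : Type*} [TopologicalSpace M] [ChartedSpace (MSpace d) M]
  [IsManifold 𝓘(ℝ, MSpace d) ∞ M]

/-- The trivialization of the tangent bundle around `x₀`. -/
abbrev tangentTriv (d : ℕ) {M : Type*} [TopologicalSpace M] [ChartedSpace (MSpace d) M]
    [IsManifold 𝓘(ℝ, MSpace d) ∞ M] (x₀ : M) :=
  trivializationAt (MSpace d) (TangentSpace 𝓘(ℝ, MSpace d) : M → Type _) x₀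

/-- The trivialization around `x₀` of the bundle of linear maps `ℝ^(d+1) → T_x M`. -/
abbrev tangentHomTriv (d : ℕ) {M : Type*} [TopologicalSpace M] [ChartedSpace (MSpace d) M]
    [IsManifold 𝓘(ℝ, MSpace d) ∞ M] (x₀ : M) :=
  trivializationAt (MSpace d →L[ℝ] MSpace d)
    (fun x : M => Bundle.Trivial M (MSpace d) x →L[ℝ] TangentSpace 𝓘(ℝ, MSpace d) x) x₀

namespace FrameBundle

/-- The components of a frame in the trivialization of the tangent bundle around `x₀`. -/
def coord (x₀ : M) (u : FrameBundle d M) : MSpace d →L[ℝ] MSpace d :=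
  (tangentTriv d x₀).continuousLinearMapAt ℝ u.proj ∘L u.toHom

/-- Through this identity, smoothness of the vector bundle trivialization gives smoothness of the
base point and of the components of a frame. -/
theorem tangentHomTriv_apply (x₀ : M) (u : FrameBundle d M) :
    tangentHomTriv d x₀ u.1 = (u.proj, u.coord x₀) := by
  rw [tangentHomTriv, hom_trivializationAt, Bundle.Trivialization.continuousLinearMap_apply]
  refine Prod.ext rfl ?_
  ext v : 1
  simp [coord, toHom, proj]
  rfl

theorem tangentHomTriv_symm_apply (x₀ x : M) (A : MSpace d →L[ℝ] MSpace d) :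
    (tangentHomTriv d x₀).toOpenPartialHomeomorph.symm (x, A) =
      ⟨x, (tangentTriv d x₀).symmL ℝ x ∘L A⟩ := by
  refine (Bundle.Pretrivialization.continuousLinearMap_symm_apply (RingHom.id ℝ)
    (trivializationAt (MSpace d) (Bundle.Trivial M (MSpace d)) x₀) (tangentTriv d x₀)
    (x, A)).trans ?_
  congr 1
  ext v : 1
  simp

theorem tangentHomTriv_baseSet (x₀ : M) :
    (tangentHomTriv d x₀).baseSet = (tangentTriv d x₀).baseSet := by
  rw [hom_trivializationAt_baseSet]
  simp

theorem isUnit_coord {x₀ : M} {u : FrameBundle d M} (hu : u.proj ∈ (tangentTriv d x₀).baseSet) :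
    IsUnit (u.coord x₀) := by
  have h : Function.Bijective (u.coord x₀) := by
    have h1 : ⇑(u.coord x₀) =
        ((tangentTriv d x₀).continuousLinearEquivAt ℝ u.proj hu) ∘ u.toHom := by
      ext v : 1
      simp only [coord, ContinuousLinearMap.comp_apply, Function.comp_apply]
      exact congrFun (Bundle.Trivialization.coe_linearMapAt_of_mem _ hu) _
    rw [h1]
    exact (ContinuousLinearEquiv.bijective _).comp u.2
  rwa [ContinuousLinearMap.isUnit_iff_bijective]

/-- The frame over `x` with given components in the trivialization of the tangent bundle around
`x₀` (when `x` belongs to the domain of this trivialization). -/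
def ofCoord (x₀ x : M) (A : GLGroup d) : FrameBundle d M :=
  open Classical in
  if hx : x ∈ (tangentTriv d x₀).baseSet then
    ⟨⟨x, (tangentTriv d x₀).symmL ℝ x ∘L A.val⟩, by
      have hA : Function.Bijective A.val := (ContinuousLinearEquiv.ofUnit A).bijective
      have hT : Function.Bijective ((tangentTriv d x₀).symmL ℝ x) := by
        rw [← Bundle.Trivialization.symm_continuousLinearEquivAt_eq _ hx]
        exact ContinuousLinearEquiv.bijective _
      exact hT.comp hA⟩
  else
    -- A default frame outside the domain, still based at x so that `proj_ofCoord` needs no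
    -- hypothesis; tangent spaces are definitionally the model space.
    ⟨⟨x, A.val⟩, (ContinuousLinearEquiv.ofUnit A).bijective⟩

theorem ofCoord_val {x₀ x : M} (hx : x ∈ (tangentTriv d x₀).baseSet) (A : GLGroup d) :
    (ofCoord x₀ x A).1 = (tangentHomTriv d x₀).toOpenPartialHomeomorph.symm (x, A.val) := by
  rw [tangentHomTriv_symm_apply, ofCoord, dif_pos hx]

@[simp] theorem proj_ofCoord (x₀ x : M) (A : GLGroup d) : (ofCoord x₀ x A).proj = x := by
  unfold ofCoord
  split_ifs <;> rfl

theorem contMDiffOn_tangentHomTriv_symm (x₀ : M) :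
    ContMDiffOn (𝓘(ℝ, MSpace d).prod 𝓘(ℝ, MSpace d →L[ℝ] MSpace d)) (frameModel d) ∞
      (fun p : M × GLGroup d =>
        (tangentHomTriv d x₀).toOpenPartialHomeomorph.symm (p.1, p.2.val))
      ((tangentTriv d x₀).baseSet ×ˢ univ) := by
  have h0 : ContMDiffOn (𝓘(ℝ, MSpace d).prod 𝓘(ℝ, MSpace d →L[ℝ] MSpace d)) (frameModel d) ∞
      (tangentHomTriv d x₀).toOpenPartialHomeomorph.symm (tangentHomTriv d x₀).target :=
    (tangentHomTriv d x₀).contMDiffOn_symm (n := ∞) (IB := 𝓘(ℝ, MSpace d))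
  have h2 : ContMDiff (𝓘(ℝ, MSpace d).prod 𝓘(ℝ, MSpace d →L[ℝ] MSpace d))
      (𝓘(ℝ, MSpace d).prod 𝓘(ℝ, MSpace d →L[ℝ] MSpace d)) ∞
      (fun p : M × GLGroup d => (p.1, p.2.val)) :=
    contMDiff_fst.prodMk (Units.contMDiff_val.comp contMDiff_snd)
  have h3 : (tangentTriv d x₀).baseSet ×ˢ univ ⊆
      (fun p : M × GLGroup d => (p.1, p.2.val)) ⁻¹' (tangentHomTriv d x₀).target := by
    intro p hp
    rw [mem_preimage, Bundle.Trivialization.mem_target, tangentHomTriv_baseSet]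
    exact hp.1
  exact h0.comp h2.contMDiffOn h3

theorem contMDiffOn_ofCoord (x₀ : M) :
    ContMDiffOn (𝓘(ℝ, MSpace d).prod 𝓘(ℝ, MSpace d →L[ℝ] MSpace d)) (frameModel d) ∞
      (fun p : M × GLGroup d => ofCoord x₀ p.1 p.2) ((tangentTriv d x₀).baseSet ×ˢ univ) := by
  intro p hp
  rw [← ContMDiffWithinAt.subtypeVal_comp_iff]
  exact (contMDiffOn_tangentHomTriv_symm x₀ p hp).congr (fun q hq => ofCoord_val hq.1 _)
    (ofCoord_val hp.1 _)

/-- The local trivialization of the frame bundle around `x₀`. -/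
def triv (x₀ : M) : PartialDiffeomorph (frameModel d)
    (𝓘(ℝ, MSpace d).prod 𝓘(ℝ, MSpace d →L[ℝ] MSpace d)) (FrameBundle d M) (M × GLGroup d) ∞ where
  toFun u := (u.proj, unitsLift (fun u : FrameBundle d M => u.coord x₀) u)
  invFun p := ofCoord x₀ p.1 p.2
  source := FrameBundle.proj ⁻¹' (tangentTriv d x₀).baseSet
  target := (tangentTriv d x₀).baseSet ×ˢ univ
  map_source' u hu := ⟨hu, mem_univ _⟩
  map_target' p hp := by
    rw [mem_preimage, proj_ofCoord]
    exact hp.1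
  left_inv' u hu := by
    have hu' : u.1 ∈ (tangentHomTriv d x₀).source := by
      rw [Bundle.Trivialization.mem_source, tangentHomTriv_baseSet]
      exact hu
    refine Subtype.ext ?_
    rw [ofCoord_val hu, unitsLift_val (isUnit_coord hu), ← tangentHomTriv_apply]
    exact (tangentHomTriv d x₀).left_inv hu'
  right_inv' := by
    rintro ⟨x, A⟩ ⟨hx, -⟩
    refine Prod.ext (proj_ofCoord _ _ _) (Units.ext ?_)
    have h1 : (ofCoord x₀ x A).proj ∈ (tangentTriv d x₀).baseSet := by rwa [proj_ofCoord]
    have h2 : (x, A.val) ∈ (tangentHomTriv d x₀).target := by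
      rw [Bundle.Trivialization.mem_target, tangentHomTriv_baseSet]
      exact hx
    have h3 := tangentHomTriv_apply x₀ (ofCoord x₀ x A)
    rw [ofCoord_val hx] at h3
    have h4 := (tangentHomTriv d x₀).right_inv h2
    rw [unitsLift_val (isUnit_coord h1)]
    exact (congrArg Prod.snd (h3.symm.trans h4))
  open_source := by
    have hc : Continuous (FrameBundle.proj : FrameBundle d M → M) :=
      (FiberBundle.continuous_proj _ _).comp continuous_subtype_val
    exact (tangentTriv d x₀).open_baseSet.preimage hc
  open_target := (tangentTriv d x₀).open_baseSet.prod isOpen_univ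
  contMDiffOn_toFun := by
    have h1 : ContMDiffOn (frameModel d)
        (𝓘(ℝ, MSpace d).prod 𝓘(ℝ, MSpace d →L[ℝ] MSpace d)) ∞
        (fun u : FrameBundle d M => tangentHomTriv d x₀ u.1)
        (FrameBundle.proj ⁻¹' (tangentTriv d x₀).baseSet) := by
      refine ((tangentHomTriv d x₀).contMDiffOn (n := ∞) (IB := 𝓘(ℝ, MSpace d))).comp
        contMDiff_subtype_val.contMDiffOn fun u hu => ?_
      rw [mem_preimage, Bundle.Trivialization.mem_source, tangentHomTriv_baseSet]
      exact hu
    simp only [tangentHomTriv_apply] at h1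
    rw [contMDiffOn_prod_iff] at h1 ⊢
    exact ⟨h1.1, contMDiffOn_unitsLift h1.2 fun u hu => isUnit_coord hu⟩
  contMDiffOn_invFun := contMDiffOn_ofCoord x₀

end FrameBundle
end FrameTrivialization

/-! ### Reductions given by local sections -/

section Reductions

theorem FrameBundle.contMDiffOn_comp_fst {d : ℕ} {M : Type*} [TopologicalSpace M]
    [ChartedSpace (MSpace d) M] {U : Set M} {S : M → GLGroup d}
    (hS : ContMDiffOn 𝓘(ℝ, MSpace d) 𝓘(ℝ, MSpace d →L[ℝ] MSpace d) ∞ S U) :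
    ContMDiffOn (𝓘(ℝ, MSpace d).prod 𝓘(ℝ, MSpace d →L[ℝ] MSpace d))
      𝓘(ℝ, MSpace d →L[ℝ] MSpace d) ∞ (fun p : M × GLGroup d => S p.1) (U ×ˢ univ) :=
  hS.comp (contMDiff_fst (M := M) (N := GLGroup d)).contMDiffOn fun _ hp => hp.1

variable {d : ℕ} {M : Type*} [TopologicalSpace M] [ChartedSpace (MSpace d) M]
  [IsManifold 𝓘(ℝ, MSpace d) ∞ M]

namespace FrameBundle

theorem continuous_proj : Continuous (FrameBundle.proj : FrameBundle d M → M) :=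
  (FiberBundle.continuous_proj _ _).comp continuous_subtype_val

theorem mem_tangentTriv_baseSet (x : M) : x ∈ (tangentTriv d x).baseSet :=
  mem_baseSet_trivializationAt _ _ x

/-- The components of a frame in the trivialization around `x₀`, as an invertible map. -/
def unitCoord (x₀ : M) (u : FrameBundle d M) : GLGroup d :=
  unitsLift (fun u : FrameBundle d M => u.coord x₀) u

theorem unitCoord_val {x₀ : M} {u : FrameBundle d M}
    (hu : u.proj ∈ (tangentTriv d x₀).baseSet) : (u.unitCoord x₀).val = u.coord x₀ :=
  unitsLift_val (isUnit_coord hu)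

theorem unitCoord_act {x₀ : M} {u : FrameBundle d M}
    (hu : u.proj ∈ (tangentTriv d x₀).baseSet) (A : GLGroup d) :
    (u.act A).unitCoord x₀ = u.unitCoord x₀ * A := by
  have hu' : (u.act A).proj ∈ (tangentTriv d x₀).baseSet := hu
  refine Units.ext ?_
  rw [unitCoord_val hu', Units.val_mul, unitCoord_val hu]
  rfl

theorem ofCoord_unitCoord {x₀ : M} {u : FrameBundle d M}
    (hu : u.proj ∈ (tangentTriv d x₀).baseSet) : ofCoord x₀ u.proj (u.unitCoord x₀) = u :=
  (triv x₀).left_inv' hu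

theorem unitCoord_ofCoord {x₀ x : M} (hx : x ∈ (tangentTriv d x₀).baseSet) (A : GLGroup d) :
    (ofCoord x₀ x A).unitCoord x₀ = A :=
  congrArg Prod.snd ((triv x₀).right_inv' (x := (x, A)) ⟨hx, mem_univ _⟩)

theorem ofCoord_act {x₀ x : M} (hx : x ∈ (tangentTriv d x₀).baseSet) (A B : GLGroup d) :
    (ofCoord x₀ x A).act B = ofCoord x₀ x (A * B) := by
  have h : (ofCoord x₀ x A).proj ∈ (tangentTriv d x₀).baseSet := by rwa [proj_ofCoord]
  have h' : ((ofCoord x₀ x A).act B).proj ∈ (tangentTriv d x₀).baseSet := h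
  have hp : ((ofCoord x₀ x A).act B).proj = x := proj_ofCoord x₀ x A
  rw [← ofCoord_unitCoord h', unitCoord_act h, unitCoord_ofCoord hx, hp]

theorem contMDiffOn_unitCoord (x₀ : M) :
    ContMDiffOn (frameModel d) 𝓘(ℝ, MSpace d →L[ℝ] MSpace d) ∞
      (unitCoord x₀ : FrameBundle d M → GLGroup d)
      (FrameBundle.proj ⁻¹' (tangentTriv d x₀).baseSet) :=
  contMDiff_snd.comp_contMDiffOn (triv x₀).contMDiffOn_toFun

theorem contMDiff_proj :
    ContMDiff (frameModel d) 𝓘(ℝ, MSpace d) ∞ (FrameBundle.proj : FrameBundle d M → M) :=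
  fun u => ((triv u.proj).contMDiffOn_toFun.contMDiffAt
    ((triv u.proj).open_source.mem_nhds (mem_tangentTriv_baseSet u.proj))).fst

/-- Two frames at the same point differ by a linear transformation. -/
theorem exists_act_eq {u v : FrameBundle d M} (h : u.proj = v.proj) : ∃ A, v = u.act A := by
  have hu := mem_tangentTriv_baseSet (d := d) u.proj
  have hv : v.proj ∈ (tangentTriv d u.proj).baseSet := h ▸ hu
  refine ⟨(u.unitCoord u.proj)⁻¹ * v.unitCoord u.proj, ?_⟩
  have h1 := ofCoord_act hu (u.unitCoord u.proj) ((u.unitCoord u.proj)⁻¹ * v.unitCoord u.proj)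
  have h2 := ofCoord_unitCoord hv
  rw [ofCoord_unitCoord hu, mul_inv_cancel_left] at h1
  rw [h1, h]
  rw [h] at h2
  exact h2.symm

/-- The change of trivialization given by a smooth map to the general linear group. -/
def gaugeTransform {U : Set M} (hU : IsOpen U) {S : M → GLGroup d}
    (hS : ContMDiffOn 𝓘(ℝ, MSpace d) 𝓘(ℝ, MSpace d →L[ℝ] MSpace d) ∞ S U) :
    PartialDiffeomorph (𝓘(ℝ, MSpace d).prod 𝓘(ℝ, MSpace d →L[ℝ] MSpace d))
      (𝓘(ℝ, MSpace d).prod 𝓘(ℝ, MSpace d →L[ℝ] MSpace d)) (M × GLGroup d) (M × GLGroup d) ∞ where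
  toFun p := (p.1, (S p.1)⁻¹ * p.2)
  invFun p := (p.1, S p.1 * p.2)
  source := U ×ˢ univ
  target := U ×ˢ univ
  map_source' _ hp := hp
  map_target' _ hp := hp
  left_inv' p _ := by simp
  right_inv' p _ := by simp
  open_source := hU.prod isOpen_univ
  open_target := hU.prod isOpen_univ
  contMDiffOn_toFun := by
    have h := contMDiffOn_comp_fst hS
    exact contMDiff_fst.contMDiffOn.prodMk (h.inv.mul contMDiff_snd.contMDiffOn)
  contMDiffOn_invFun := by
    have h := contMDiffOn_comp_fst hS
    exact contMDiff_fst.contMDiffOn.prodMk (h.mul contMDiff_snd.contMDiffOn)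

end FrameBundle

/-- `Q` has smooth local sections, and `H` acts simply transitively on its fibres. -/
structure HasSmoothReduction (Q : Set (FrameBundle d M)) (H : Subgroup (GLGroup d)) : Prop where
  exists_section : ∀ x₀ : M, ∃ U : Set M, IsOpen U ∧ x₀ ∈ U ∧ U ⊆ (tangentTriv d x₀).baseSet ∧
    ∃ S : M → GLGroup d, ContMDiffOn 𝓘(ℝ, MSpace d) 𝓘(ℝ, MSpace d →L[ℝ] MSpace d) ∞ S U ∧
      ∀ y ∈ U, FrameBundle.ofCoord x₀ y (S y) ∈ Q
  act_mem_iff : ∀ u ∈ Q, ∀ A, u.act A ∈ Q ↔ A ∈ H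

theorem FrameQuot.pr_eq_iff {H : Subgroup (GLGroup d)} {u v : FrameBundle d M} :
    FrameQuot.pr H u = FrameQuot.pr H v ↔ ∃ A ∈ H, v = u.act A :=
  Quotient.eq (r := frameSetoid d M H)

namespace HasSmoothReduction

open FrameBundle

variable {Q : Set (FrameBundle d M)} {H : Subgroup (GLGroup d)}

/-- Left multiplication of the frame components by S⁻¹ commutes with the right action and sends the
section to the identity. A frame then differs from the section by exactly its new coordinate, and
`act_mem_iff` decides whether it lies in Q. -/
theorem locally_trivial (hQ : HasSmoothReduction Q H) (x : M) :
    ∃ U : Set M, IsOpen U ∧ x ∈ U ∧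
    ∃ Φ : PartialDiffeomorph (frameModel d)
        (𝓘(ℝ, MSpace d).prod 𝓘(ℝ, MSpace d →L[ℝ] MSpace d)) (FrameBundle d M) (M × GLGroup d) ∞,
      Φ.source = FrameBundle.proj ⁻¹' U ∧ Φ.target = U ×ˢ univ ∧
      ∀ u ∈ Φ.source, (Φ u).1 = u.proj ∧
        (∀ A : GLGroup d, (Φ (u.act A)).2 = (Φ u).2 * A) ∧
        (u ∈ Q ↔ (Φ u).2 ∈ H) := by
  obtain ⟨U, hU, hx, hUb, S, hS, hSQ⟩ := hQ.exists_section x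
  refine ⟨U, hU, hx, (triv x).trans (gaugeTransform hU hS), ?_, ?_, ?_⟩
  · ext u
    change (u.proj ∈ (tangentTriv d x).baseSet ∧ (u.proj ∈ U ∧ True)) ↔ u.proj ∈ U
    exact ⟨fun h => h.2.1, fun h => ⟨hUb h, h, trivial⟩⟩
  · ext p
    change ((p.1 ∈ U ∧ True) ∧ (p.1 ∈ (tangentTriv d x).baseSet ∧ True)) ↔ (p.1 ∈ U ∧ True)
    exact ⟨fun h => h.1, fun h => ⟨h, hUb h.1, trivial⟩⟩
  · rintro u ⟨hu, huU, -⟩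
    change u.proj ∈ (tangentTriv d x).baseSet at hu
    change u.proj ∈ U at huU
    refine ⟨rfl, fun A => ?_, ?_⟩
    · change (S u.proj)⁻¹ * (u.act A).unitCoord x = (S u.proj)⁻¹ * u.unitCoord x * A
      rw [unitCoord_act hu, mul_assoc]
    · change u ∈ Q ↔ (S u.proj)⁻¹ * u.unitCoord x ∈ H
      rw [← hQ.act_mem_iff _ (hSQ _ huU), ofCoord_act hu, mul_inv_cancel_left,
        ofCoord_unitCoord hu]

/-- In an adapted trivialization Q is U × H, so a chart of M times a slice chart of H flattens it.
-/
theorem isEmbeddedSubmanifold (hQ : HasSmoothReduction Q H) (hH : IsOpenLorentzSubgroup H) :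
    IsEmbeddedSubmanifold (frameModel d) Q := by
  refine ⟨Submodule.prod ⊤ (lorentzSkew d), fun p hp => ?_⟩
  obtain ⟨U, -, hpU, Φ, hΦs, -, hΦ⟩ := hQ.locally_trivial p.proj
  have hpΦ : p ∈ Φ.source := by rw [hΦs]; exact hpU
  obtain ⟨c, hc1, hc2, hc3, hc4⟩ := hH.exists_chart (((hΦ p hpΦ).2.2).1 hp)
  let ψ := (chartAt (MSpace d) p.proj).prod c
  have hψ : ψ ∈ IsManifold.maximalAtlas
      (𝓘(ℝ, MSpace d).prod 𝓘(ℝ, MSpace d →L[ℝ] MSpace d)) ∞ (M × GLGroup d) :=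
    IsManifold.mem_maximalAtlas_prod (IsManifold.chart_mem_maximalAtlas p.proj)
      (c.mem_maximalAtlas_of_contMDiffOn hc1 hc2)
  have hψ1 := contMDiffOn_of_mem_maximalAtlas hψ
  have hψ2 := contMDiffOn_symm_of_mem_maximalAtlas hψ
  let φ : OpenPartialHomeomorph (FrameBundle d M) (ModelProd (MSpace d) (MSpace d →L[ℝ] MSpace d)) :=
    Φ.toOpenPartialHomeomorph.trans ψ
  refine ⟨φ, φ.mem_maximalAtlas_of_contMDiffOn ?_ ?_, ?_, ?_⟩
  · exact hψ1.comp (Φ.contMDiffOn_toFun.mono fun u hu => hu.1) fun u hu => hu.2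
  · exact Φ.contMDiffOn_invFun.comp (hψ2.mono fun u hu => hu.1) fun u hu => hu.2
  · refine ⟨hpΦ, ?_, hc3⟩
    change (Φ p).1 ∈ _
    rw [(hΦ p hpΦ).1]
    exact mem_chart_source _ _
  · rintro q ⟨hq, hq1, hq2⟩
    change q ∈ Q ↔ (True ∧ c (Φ q).2 ∈ lorentzSkew d)
    rw [true_and, (hΦ q hq).2.2]
    exact hc4 _ hq2

theorem isReducedSubbundle (hQ : HasSmoothReduction Q H) (hH : IsOpenLorentzSubgroup H) :
    IsReducedSubbundle Q H where
  lieSubgroup := hH.isEmbeddedSubmanifold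
  submanifold := hQ.isEmbeddedSubmanifold hH
  act_mem u hu A hA := (hQ.act_mem_iff u hu A).2 hA
  locally_trivial := hQ.locally_trivial

theorem exists_mem (hQ : HasSmoothReduction Q H) (x : M) : ∃ u ∈ Q, u.proj = x := by
  obtain ⟨U, hU, hx, hUb, S, hS, hSQ⟩ := hQ.exists_section x
  exact ⟨_, hSQ x hx, proj_ofCoord _ _ _⟩

theorem pr_eq (hQ : HasSmoothReduction Q H) {u v : FrameBundle d M} (hu : u ∈ Q) (hv : v ∈ Q)
    (h : u.proj = v.proj) : FrameQuot.pr H u = FrameQuot.pr H v := by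
  obtain ⟨A, rfl⟩ := exists_act_eq h
  exact FrameQuot.pr_eq_iff.2 ⟨A, (hQ.act_mem_iff u hu A).1 hv, rfl⟩

/-- The fibres of Q are nonempty and each lies in a single H-class, so the first condition alone
determines s. -/
theorem existsUnique_section (hQ : HasSmoothReduction Q H) :
    ∃! s : M → FrameQuot d M H,
      (∀ u ∈ Q, s u.proj = FrameQuot.pr H u) ∧
      (∀ x, (s x).proj = x) ∧
      IsSmoothToQuotient s ∧
      Q = {u | FrameQuot.pr H u ∈ range s} := by
  choose f hfQ hfp using hQ.exists_mem
  have hs : ∀ u ∈ Q, FrameQuot.pr H (f u.proj) = FrameQuot.pr H u := fun u hu =>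
    hQ.pr_eq (hfQ _) hu (hfp _)
  refine ⟨fun x => FrameQuot.pr H (f x), ⟨hs, hfp, ?_, ?_⟩, ?_⟩
  -- Near x, s is `pr` composed with a smooth local section of Q, so it is smooth for any structure
  -- making `pr` smooth.
  · intro m cs hcs x
    obtain ⟨U, hU, hx, hUb, S, hS, hSQ⟩ := hQ.exists_section x
    have h1 : ContMDiffOn 𝓘(ℝ, MSpace d) (frameModel d) ∞ (fun y => ofCoord x y (S y)) U :=
      (contMDiffOn_ofCoord x).comp (contMDiffOn_id.prodMk hS) fun y hy => ⟨hUb hy, mem_univ _⟩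
    have h2 := (hcs.2.1.comp_contMDiffOn h1).contMDiffAt (hU.mem_nhds hx)
    refine h2.congr_of_eventuallyEq ?_
    filter_upwards [hU.mem_nhds hx] with y hy
    exact hQ.pr_eq (hfQ y) (hSQ y hy) ((hfp y).trans (proj_ofCoord _ _ _).symm)
  · ext u
    constructor
    · exact fun hu => ⟨u.proj, hs u hu⟩
    · rintro ⟨x, hx⟩
      obtain ⟨A, hA, rfl⟩ := FrameQuot.pr_eq_iff.1 hx
      exact (hQ.act_mem_iff _ (hfQ x) A).2 hA
  · rintro s ⟨h, -⟩
    funext x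
    have := h _ (hfQ x)
    rwa [hfp] at this

end HasSmoothReduction
end Reductions

/-! ### The quotient of the frame bundle by an open subgroup of the Lorentz group -/

/-- Linear coordinates on the self-adjoint operators. Extending ρ to all of E by a projection lets
it be composed with operator-valued maps without restricting their codomain. -/
theorem Submodule.exists_euclidean_coordinates {E : Type*} [NormedAddCommGroup E]
    [NormedSpace ℝ E] [FiniteDimensional ℝ E] (W : Submodule ℝ E) :
    ∃ (k : ℕ) (ι : EuclideanSpace ℝ (Fin k) →L[ℝ] E) (ρ : E →L[ℝ] EuclideanSpace ℝ (Fin k)),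
      (∀ t, ι t ∈ W) ∧ (∀ t, ρ (ι t) = t) ∧ ∀ X ∈ W, ι (ρ X) = X := by
  obtain ⟨p, hp⟩ := LinearMap.exists_leftInverse_of_injective W.subtype W.ker_subtype
  have hp' : ∀ w : W, p w = w := fun w => LinearMap.congr_fun hp w
  let L : W ≃L[ℝ] EuclideanSpace ℝ (Fin (Module.finrank ℝ W)) := toEuclidean
  refine ⟨_, W.subtypeL.comp L.symm.toContinuousLinearMap,
    L.toContinuousLinearMap.comp (LinearMap.toContinuousLinearMap p), ?_, ?_, ?_⟩
  · exact fun t => (L.symm t).2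
  · intro t
    change L (p (L.symm t : W)) = t
    rw [hp', L.apply_symm_apply]
  · intro X hX
    change ((L.symm (L (p X)) : W) : E) = X
    rw [L.symm_apply_apply]
    exact congrArg Subtype.val (hp' ⟨X, hX⟩)

section LorentzSlices

variable {d : ℕ}

/-- Multiplying B B* by A⁻¹ on the left and (A⁻¹)* on the right gives (A⁻¹B)(A⁻¹B)*. Thus A A* is a
complete invariant of the coset A·O(1,d). -/
theorem mul_lorentzAdj_eq_iff {A B : GLGroup d} :
    A.val * lorentzAdj d A.val = B.val * lorentzAdj d B.val ↔ A⁻¹ * B ∈ lorentzGroup d := by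
  have h : lorentzAdj d A.val * lorentzAdj d (A⁻¹).val = 1 := by
    rw [← lorentzAdj_mul, Units.inv_mul, lorentzAdj_one]
  have h' : lorentzAdj d (A⁻¹).val * lorentzAdj d A.val = 1 := by
    rw [← lorentzAdj_mul, Units.mul_inv, lorentzAdj_one]
  rw [mem_lorentzGroup_iff', Units.val_mul, lorentzAdj_mul]
  constructor
  · intro hAB
    calc _ = (A⁻¹).val * (B.val * lorentzAdj d B.val) * lorentzAdj d (A⁻¹).val := by
          simp only [mul_assoc]
      _ = ((A⁻¹).val * A.val) * (lorentzAdj d A.val * lorentzAdj d (A⁻¹).val) := by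
          rw [← hAB]; simp only [mul_assoc]
      _ = 1 := by rw [h, Units.inv_mul, one_mul]
  · intro hAB
    calc _ = A.val * 1 * lorentzAdj d A.val := by rw [mul_one]
      _ = (A.val * (A⁻¹).val) * (B.val * lorentzAdj d B.val) *
          (lorentzAdj d (A⁻¹).val * lorentzAdj d A.val) := by
          rw [← hAB]; simp only [mul_assoc]
      _ = _ := by rw [h', Units.mul_inv, one_mul, mul_one]

theorem exists_lorentz_sqrt_units (d : ℕ) :
    ∃ (T : Set (MSpace d →L[ℝ] MSpace d)) (κ : (MSpace d →L[ℝ] MSpace d) → GLGroup d),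
      IsOpen T ∧ 1 ∈ T ∧
      ContMDiffOn 𝓘(ℝ, MSpace d →L[ℝ] MSpace d) 𝓘(ℝ, MSpace d →L[ℝ] MSpace d) ∞ κ T ∧ κ 1 = 1 ∧
      ∀ S ∈ T, S ∈ lorentzSym d → (κ S).val * lorentzAdj d (κ S).val = S := by
  obtain ⟨T, κ, hT, h1, hs, hκ1, hu, hκ⟩ := exists_lorentz_sqrt d
  refine ⟨T, unitsLift κ, hT, h1, contMDiffOn_unitsLift hs.contMDiffOn hu, Units.ext ?_, ?_⟩
  · rw [unitsLift_val (hu 1 h1), hκ1, Units.val_one]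
  · intro S hS hS'
    rw [unitsLift_val (hu S hS), hκ S hS hS']

end LorentzSlices

/-! ### Topology and smooth structure of L(M)/H -/

section FrameQuotient

variable {d : ℕ} {M : Type*} [TopologicalSpace M] [ChartedSpace (MSpace d) M]
  [IsManifold 𝓘(ℝ, MSpace d) ∞ M]

open FrameBundle

namespace FrameBundle

theorem isOpen_domain (x₀ : M) :
    IsOpen (FrameBundle.proj ⁻¹' (tangentTriv d x₀).baseSet : Set (FrameBundle d M)) :=
  (triv x₀).open_source

theorem continuous_act (A : GLGroup d) : Continuous fun u : FrameBundle d M => u.act A := by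
  rw [continuous_iff_continuousAt]
  intro u
  have hu := mem_tangentTriv_baseSet (d := d) u.proj
  have hn := (isOpen_domain u.proj).mem_nhds hu
  have h1 : ContinuousAt (fun v : FrameBundle d M => (v.proj, v.unitCoord u.proj * A)) u :=
    continuous_proj.continuousAt.prodMk
      (((contMDiffOn_unitCoord u.proj).continuousOn.continuousAt hn).mul continuousAt_const)
  have h2 : ContinuousAt (fun p : M × GLGroup d => ofCoord u.proj p.1 p.2)
      (u.proj, u.unitCoord u.proj * A) :=
    (contMDiffOn_ofCoord u.proj).continuousOn.continuousAt
      ((triv u.proj).open_target.mem_nhds ⟨hu, mem_univ _⟩)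
  refine (ContinuousAt.comp (f := fun v : FrameBundle d M => (v.proj, v.unitCoord u.proj * A))
    h2 h1).congr ?_
  filter_upwards [hn] with v hv
  have hv' : (v.act A).proj ∈ (tangentTriv d u.proj).baseSet := hv
  rw [Function.comp_apply, ← unitCoord_act hv]
  exact ofCoord_unitCoord hv'

end FrameBundle

namespace FrameQuot

variable {H : Subgroup (GLGroup d)}

/-- The saturation of an open set is a union of its preimages under the continuous maps u ↦ u·A with
A ∈ H. -/
theorem isOpenQuotientMap_pr (H : Subgroup (GLGroup d)) :
    IsOpenQuotientMap (FrameQuot.pr H : FrameBundle d M → FrameQuot d M H) := by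
  refine ⟨Quotient.mk_surjective, continuous_quotient_mk', fun O hO => ?_⟩
  refine isQuotientMap_quotient_mk'.isOpen_preimage.1 ?_
  have h : (FrameQuot.pr H : FrameBundle d M → FrameQuot d M H) ⁻¹' (FrameQuot.pr H '' O) =
      ⋃ A ∈ H, (fun u : FrameBundle d M => u.act A) ⁻¹' O := by
    ext u
    simp only [mem_preimage, mem_image, mem_iUnion, exists_prop]
    constructor
    · rintro ⟨v, hv, hvu⟩
      obtain ⟨A, hA, rfl⟩ := pr_eq_iff.1 hvu.symm
      exact ⟨A, hA, hv⟩
    · rintro ⟨A, hA, hv⟩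
      exact ⟨_, hv, (pr_eq_iff.2 ⟨A, hA, rfl⟩).symm⟩
  exact h ▸ isOpen_biUnion fun A _ => hO.preimage (continuous_act A)

theorem pr_eq_iff_coord {x₀ : M} {u v : FrameBundle d M}
    (hu : u.proj ∈ (tangentTriv d x₀).baseSet) :
    FrameQuot.pr H u = FrameQuot.pr H v ↔
      v.proj = u.proj ∧ (u.unitCoord x₀)⁻¹ * v.unitCoord x₀ ∈ H := by
  rw [pr_eq_iff]
  constructor
  · rintro ⟨A, hA, rfl⟩
    refine ⟨rfl, ?_⟩
    rwa [unitCoord_act hu, inv_mul_cancel_left]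
  · rintro ⟨h, hA⟩
    refine ⟨_, hA, ?_⟩
    have hv : v.proj ∈ (tangentTriv d x₀).baseSet := h ▸ hu
    have h1 := ofCoord_act hu (u.unitCoord x₀) ((u.unitCoord x₀)⁻¹ * v.unitCoord x₀)
    have h2 := ofCoord_unitCoord hv
    rw [ofCoord_unitCoord hu, mul_inv_cancel_left] at h1
    rw [h1, ← h, h2]

/-- For an open quotient map it suffices that the equivalence relation is closed. Frames over
different points are handled by M being Hausdorff; over a common point, the relative coordinate is
continuous and avoids the closed set H. -/
theorem t2Space [T2Space M] (hH : IsClosed (H : Set (GLGroup d))) :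
    T2Space (FrameQuot d M H) := by
  rw [t2Space_iff_of_isOpenQuotientMap (isOpenQuotientMap_pr H), ← isOpen_compl_iff,
    isOpen_iff_mem_nhds]
  rintro ⟨u, v⟩ huv
  change ¬ FrameQuot.pr H u = FrameQuot.pr H v at huv
  have hp1 : Continuous fun p : FrameBundle d M × FrameBundle d M => p.1.proj :=
    continuous_proj.comp continuous_fst
  have hp2 : Continuous fun p : FrameBundle d M × FrameBundle d M => p.2.proj :=
    continuous_proj.comp continuous_snd
  by_cases hp : v.proj = u.proj
  · have hu := mem_tangentTriv_baseSet (d := d) u.proj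
    have hv : v.proj ∈ (tangentTriv d u.proj).baseSet := hp ▸ hu
    have hnu := (isOpen_domain u.proj).mem_nhds hu
    have hnv := (isOpen_domain u.proj).mem_nhds hv
    have hcu : ContinuousAt (unitCoord u.proj) u :=
      (contMDiffOn_unitCoord u.proj).continuousOn.continuousAt hnu
    have hcv : ContinuousAt (unitCoord u.proj) v :=
      (contMDiffOn_unitCoord u.proj).continuousOn.continuousAt hnv
    have hc : ContinuousAt (fun p : FrameBundle d M × FrameBundle d M =>
        (p.1.unitCoord u.proj)⁻¹ * p.2.unitCoord u.proj) (u, v) :=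
      (ContinuousAt.comp (f := Prod.fst) hcu continuousAt_fst).inv.mul
        (ContinuousAt.comp (f := Prod.snd) hcv continuousAt_snd)
    have hnot : (u.unitCoord u.proj)⁻¹ * v.unitCoord u.proj ∈ (H : Set (GLGroup d))ᶜ :=
      fun h => huv ((pr_eq_iff_coord hu).2 ⟨hp, h⟩)
    filter_upwards [hc (hH.isOpen_compl.mem_nhds hnot),
      continuousAt_fst.preimage_mem_nhds hnu] with p hp1 hp2 hp3
    exact hp1 ((pr_eq_iff_coord hp2).1 hp3).2
  · filter_upwards [(isOpen_ne_fun hp2 hp1).mem_nhds hp] with p hp1 hp3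
    obtain ⟨A, -, hA⟩ := pr_eq_iff.1 hp3
    exact hp1 (by rw [hA]; rfl)

end FrameQuot

/-- The slice coordinates of a frame are its base point and S = C C*, where C are its components
relative to u₀. These determine the class modulo O(1,d). The remaining factor R = κ(S)⁻¹C is
Lorentz, and requiring R ∈ H picks the sheet of L(M)/H that contains u₀. -/
theorem exists_quotientSlice {H : Subgroup (GLGroup d)} (hH : IsOpenLorentzSubgroup H)
    {m k : ℕ} (L : (MSpace d × EuclideanSpace ℝ (Fin k)) ≃L[ℝ] EuclideanSpace ℝ (Fin m))
    (ι : EuclideanSpace ℝ (Fin k) →L[ℝ] (MSpace d →L[ℝ] MSpace d))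
    (ρ : (MSpace d →L[ℝ] MSpace d) →L[ℝ] EuclideanSpace ℝ (Fin k))
    (hι : ∀ t, ι t ∈ lorentzSym d) (hρι : ∀ t, ρ (ι t) = t)
    (hιρ : ∀ X ∈ lorentzSym d, ι (ρ X) = X) (u₀ : FrameBundle d M) :
    ∃ s : QuotientSlice (frameModel d) (EuclideanSpace ℝ (Fin m))
      (FrameQuot.pr H : FrameBundle d M → FrameQuot d M H),
      u₀ ∈ s.source ∧ s.lift (s.toFun u₀) = u₀ := by
  obtain ⟨V, hV, hHV⟩ := hH
  obtain ⟨T, κ, hT, h1, hκs, hκ1, hκ⟩ := exists_lorentz_sqrt_units d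
  set x₀ := u₀.proj with hx₀
  set A₀ := u₀.unitCoord x₀ with hA₀
  let φ := chartAt (MSpace d) x₀
  -- The tangent trivialization lives exactly on the chart domain, so one open set serves for base
  -- coordinates and frame components.
  have hφ : (tangentTriv d x₀).baseSet = φ.source := rfl
  -- The normalization by A₀ gives C u₀ = 1 and S u₀ = 1, where κ is defined and equals 1.
  let C : FrameBundle d M → GLGroup d := fun u => A₀⁻¹ * u.unitCoord x₀
  let S : FrameBundle d M → MSpace d →L[ℝ] MSpace d := fun u => (C u).val * lorentzAdj d (C u).val
  let D : Set (FrameBundle d M) := FrameBundle.proj ⁻¹' (tangentTriv d x₀).baseSet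
  have hD : IsOpen D := isOpen_domain x₀
  have hSsym : ∀ u, S u ∈ lorentzSym d := fun u => mul_lorentzAdj_mem_lorentzSym _
  have hCs : ContMDiffOn (frameModel d) 𝓘(ℝ, MSpace d →L[ℝ] MSpace d) ∞ C D :=
    contMDiffOn_const.mul (contMDiffOn_unitCoord x₀)
  have hCv : ContMDiffOn (frameModel d) 𝓘(ℝ, MSpace d →L[ℝ] MSpace d) ∞ (fun u => (C u).val) D :=
    contMDiffOn_units_iff.1 hCs
  have hmul : ContDiff ℝ ∞ (fun X : MSpace d →L[ℝ] MSpace d => X * lorentzAdj d X) :=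
    contDiff_id.mul (lorentzAdj d).contDiff
  have hSs : ContMDiffOn (frameModel d) 𝓘(ℝ, MSpace d →L[ℝ] MSpace d) ∞ S D :=
    hmul.contMDiff.comp_contMDiffOn hCv
  let D' : Set (FrameBundle d M) := D ∩ S ⁻¹' T
  have hD' : IsOpen D' := hSs.continuousOn.isOpen_inter_preimage hD hT
  let R : FrameBundle d M → GLGroup d := fun u => (κ (S u))⁻¹ * C u
  have hRc : ContinuousOn R D' :=
    ((hκs.comp (hSs.mono inter_subset_left) inter_subset_right).continuousOn.inv).mul
      (hCs.continuousOn.mono inter_subset_left)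
  have hRO : ∀ u ∈ D', R u ∈ lorentzGroup d := fun u hu =>
    mul_lorentzAdj_eq_iff.1 (hκ _ hu.2 (hSsym u))
  have hRH : ∀ u ∈ D', R u ∈ H ↔ R u ∈ V := fun u hu => by
    rw [hHV, and_iff_right (hRO u hu)]
  let P : EuclideanSpace ℝ (Fin m) → MSpace d := fun t => (L.symm t).1
  let G : EuclideanSpace ℝ (Fin m) → MSpace d →L[ℝ] MSpace d :=
    fun t => ι (L.symm t).2
  have hPs : ContDiff ℝ ∞ P := contDiff_fst.comp L.symm.contDiff
  have hGs : ContDiff ℝ ∞ G :=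
    ι.contDiff.comp (contDiff_snd.comp L.symm.contDiff)
  let F : FrameBundle d M → EuclideanSpace ℝ (Fin m) :=
    fun u => L (φ u.proj, ρ (S u))
  have hPF : ∀ u, P (F u) = φ u.proj := fun u => by simp [P, F]
  have hGF : ∀ u, G (F u) = S u := fun u => by
    simp only [G, F, ContinuousLinearEquiv.symm_apply_apply]
    exact hιρ _ (hSsym u)
  have hF_ext : ∀ t t', P t = P t' → G t = G t' → t = t' := fun t t' h h' =>
    L.symm.injective (Prod.ext h (by
      have := congrArg ρ h'
      simpa only [G, hρι] using this))
  have hGsym : ∀ t, G t ∈ lorentzSym d := fun t => hι _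
  let J : EuclideanSpace ℝ (Fin m) → FrameBundle d M :=
    fun t => ofCoord x₀ (φ.symm (P t)) (A₀ * κ (G t))
  let W : Set (EuclideanSpace ℝ (Fin m)) := P ⁻¹' φ.target ∩ G ⁻¹' T
  have hJp : ∀ t, (J t).proj = φ.symm (P t) := fun t => proj_ofCoord _ _ _
  have hJD : ∀ t ∈ W, J t ∈ D := fun t ht => by
    change (J t).proj ∈ φ.source
    rw [hJp]
    exact φ.map_target ht.1
  have hJC : ∀ t ∈ W, C (J t) = κ (G t) := fun t ht => by
    have hb : φ.symm (P t) ∈ (tangentTriv d x₀).baseSet := φ.map_target ht.1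
    simp only [C, J]
    rw [unitCoord_ofCoord hb, inv_mul_cancel_left]
  have hJS : ∀ t ∈ W, S (J t) = G t := fun t ht => by
    change (C (J t)).val * lorentzAdj d (C (J t)).val = G t
    rw [hJC t ht, hκ _ ht.2 (hGsym t)]
  have hfibre : ∀ u ∈ D', R u ∈ H → ∀ v, FrameQuot.pr H u = FrameQuot.pr H v ↔
      (v ∈ D' ∧ R v ∈ H) ∧ F u = F v := by
    intro u hu huH v
    have huv : (C u)⁻¹ * C v = (u.unitCoord x₀)⁻¹ * v.unitCoord x₀ := by
      simp only [C]; group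
    rw [FrameQuot.pr_eq_iff_coord hu.1, ← huv]
    constructor
    · rintro ⟨hp, hA⟩
      have hSv : S u = S v := mul_lorentzAdj_eq_iff.2 ((hHV _).1 hA).1
      have hvD : v ∈ D' := by
        refine ⟨?_, ?_⟩
        · change v.proj ∈ (tangentTriv d x₀).baseSet
          rw [hp]
          exact hu.1
        · change S v ∈ T
          rw [← hSv]
          exact hu.2
      refine ⟨⟨hvD, ?_⟩, ?_⟩
      -- S is unchanged along the H-orbit, so R is multiplied on the right by the same element of H
      -- as C.
      · have : R v = R u * ((C u)⁻¹ * C v) := by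
          simp only [R, hSv]; group
        rw [this]
        exact mul_mem huH hA
      · simp only [F, hp, hSv]
    · rintro ⟨⟨hv, hvH⟩, hF⟩
      have hSv : S u = S v := by rw [← hGF, hF, hGF]
      have hp : φ v.proj = φ u.proj := by rw [← hPF, ← hF, hPF]
      refine ⟨φ.injOn hv.1 hu.1 hp, ?_⟩
      have : (C u)⁻¹ * C v = (R u)⁻¹ * R v := by
        simp only [R, hSv]; group
      rw [this]
      exact mul_mem (inv_mem huH) hvH
  have hC0 : C u₀ = 1 := by simp only [C, ← hA₀, inv_mul_cancel]
  have hS0 : S u₀ = 1 := by simp only [S, hC0, Units.val_one, lorentzAdj_one, mul_one]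
  refine ⟨{ source := D' ∩ R ⁻¹' H
            target := W
            toFun := F
            lift := J
            open_source := ?_
            open_target := (φ.open_target.preimage hPs.continuous).inter
              (hT.preimage hGs.continuous)
            map_source := ?_
            map_target := ?_
            right_inv := ?_
            fibre_iff := fun u hu v => hfibre u hu.1 hu.2 v
            contMDiffOn_toFun := ?_
            contMDiffOn_lift := ?_ }, ?_, ?_⟩
  -- H need not be open in GL, but R takes Lorentz values on `D'`, where H is cut out by the open
  -- set V.
  · have : D' ∩ R ⁻¹' H = D' ∩ R ⁻¹' V := by
      ext u
      exact and_congr_right fun hu => hRH u hu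
    rw [this]
    exact hRc.isOpen_inter_preimage hD' hV
  · intro u hu
    refine ⟨?_, ?_⟩
    · change P (F u) ∈ φ.target
      rw [hPF]
      exact φ.map_source hu.1.1
    · change G (F u) ∈ T
      rw [hGF]
      exact hu.1.2
  · intro t ht
    refine ⟨⟨hJD t ht, ?_⟩, ?_⟩
    · change S (J t) ∈ T
      rw [hJS t ht]
      exact ht.2
    · change (κ (S (J t)))⁻¹ * C (J t) ∈ H
      rw [hJS t ht, hJC t ht, inv_mul_cancel]
      exact one_mem H
  · intro t ht
    refine hF_ext _ _ ?_ ?_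
    · rw [hPF, hJp]
      exact φ.right_inv ht.1
    · rw [hGF, hJS t ht]
  · have hproj : ContMDiffOn (frameModel d) 𝓘(ℝ, MSpace d) ∞
        (fun u : FrameBundle d M => φ u.proj) D :=
      (contMDiffOn_chart (I := 𝓘(ℝ, MSpace d)) (n := ∞) (x := x₀)).comp
        contMDiff_proj.contMDiffOn fun u hu => hu
    have hsym : ContMDiffOn (frameModel d) 𝓘(ℝ, EuclideanSpace ℝ (Fin k)) ∞
        (fun u : FrameBundle d M => ρ (S u)) D :=
      ρ.contDiff.contMDiff.comp_contMDiffOn hSs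
    have hL : ContMDiff 𝓘(ℝ, MSpace d × EuclideanSpace ℝ (Fin k))
      𝓘(ℝ, EuclideanSpace ℝ (Fin m)) ∞ L := L.contDiff.contMDiff
    exact (hL.comp_contMDiffOn (hproj.prodMk_space hsym)).mono fun u hu => hu.1.1
  · have hp : ContMDiffOn 𝓘(ℝ, EuclideanSpace ℝ (Fin m)) 𝓘(ℝ, MSpace d) ∞
        (fun t => φ.symm (P t)) W :=
      (contMDiffOn_chart_symm (I := 𝓘(ℝ, MSpace d)) (n := ∞) (x := x₀)).comp
        hPs.contMDiff.contMDiffOn fun t ht => ht.1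
    have hk : ContMDiffOn 𝓘(ℝ, EuclideanSpace ℝ (Fin m))
        𝓘(ℝ, MSpace d →L[ℝ] MSpace d) ∞ (fun t => A₀ * κ (G t)) W :=
      contMDiffOn_const.mul (hκs.comp hGs.contMDiff.contMDiffOn fun t ht => ht.2)
    exact (contMDiffOn_ofCoord x₀).comp (hp.prodMk hk) fun t ht => ⟨φ.map_target ht.1, mem_univ _⟩
  · refine ⟨⟨mem_tangentTriv_baseSet x₀, ?_⟩, ?_⟩
    · change S u₀ ∈ T
      rwa [hS0]
    · change (κ (S u₀))⁻¹ * C u₀ ∈ H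
      rw [hS0, hC0, hκ1, inv_one, one_mul]
      exact one_mem H
  · change ofCoord x₀ (φ.symm (P (F u₀))) (A₀ * κ (G (F u₀))) = u₀
    rw [hPF, hGF, hS0, hκ1, mul_one, φ.left_inv (mem_chart_source _ x₀)]
    exact ofCoord_unitCoord (mem_tangentTriv_baseSet x₀)

/-- The linear coordinates are fixed once, so the slices at all frames share one model space. -/
theorem quotientIsManifold [T2Space M] {H : Subgroup (GLGroup d)}
    (hH : IsOpenLorentzSubgroup H) : QuotientIsManifold M H := by
  obtain ⟨k, ι, ρ, hι, hρι, hιρ⟩ := (lorentzSym d).exists_euclidean_coordinates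
  let L : (MSpace d × EuclideanSpace ℝ (Fin k)) ≃L[ℝ]
    EuclideanSpace ℝ (Fin (Module.finrank ℝ (MSpace d × EuclideanSpace ℝ (Fin k)))) := toEuclidean
  choose s hs hs' using exists_quotientSlice (M := M) hH L ι ρ hι hρι hιρ
  have hpr := FrameQuot.isOpenQuotientMap_pr (M := M) H
  exact ⟨FrameQuot.t2Space hH.isClosed, _, quotientChartedSpace hpr s hs,
    isManifold_quotient hpr s hs, isSmoothSubmersion_quotient hpr s hs hs'⟩

end FrameQuotient

/-! ### Pseudo-orthonormal frames -/

section LinearAlgebra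

variable {d : ℕ}

theorem minkowski_stdVec_succ (i : Fin d) (w : MSpace d) :
    minkowski (stdVec d i.succ) w = w i.succ := by
  simp [minkowski, stdVec, Fin.succ_inj]

theorem timeReflection_stdVec_inner (a : Fin (d + 1)) (w : MSpace d) :
    minkowski (timeReflection d (stdVec d a)) w = w a := by
  rw [minkowski_eq_inner, timeReflection_timeReflection, stdVec,
    EuclideanSpace.inner_single_left]
  simp

theorem basisFun_eq_stdVec (a : Fin (d + 1)) :
    (EuclideanSpace.basisFun (Fin (d + 1)) ℝ).toBasis a = stdVec d a := by
  simp [stdVec]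

theorem sum_smul_stdVec (v : MSpace d) : ∑ a, v a • stdVec d a = v := by
  have := (EuclideanSpace.basisFun (Fin (d + 1)) ℝ).sum_repr v
  simpa [stdVec] using this

theorem minkowski_sum_left {ι : Type*} (s : Finset ι) (f : ι → MSpace d) (w : MSpace d) :
    minkowski (∑ i ∈ s, f i) w = ∑ i ∈ s, minkowski (f i) w := by
  simp only [minkowski_eq_inner, map_sum, sum_inner]

theorem minkowski_smul_left (c : ℝ) (v w : MSpace d) :
    minkowski (c • v) w = c * minkowski v w := by
  simp only [minkowski_eq_inner, map_smul, real_inner_smul_left]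

theorem minkowski_smul_right (c : ℝ) (v w : MSpace d) :
    minkowski v (c • w) = c * minkowski v w := by
  rw [minkowski_comm, minkowski_smul_left, minkowski_comm]

theorem minkowski_add_left (v v' w : MSpace d) :
    minkowski (v + v') w = minkowski v w + minkowski v' w := by
  simp only [minkowski_eq_inner, map_add, inner_add_left]

theorem minkowski_add_right (v w w' : MSpace d) :
    minkowski v (w + w') = minkowski v w + minkowski v w' := by
  simp only [minkowski_eq_inner, inner_add_right]

/-- The Minkowski form as a bilinear form. -/
def minkowskiForm (d : ℕ) : LinearMap.BilinForm ℝ (MSpace d) :=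
  LinearMap.mk₂ ℝ minkowski minkowski_add_left minkowski_smul_left minkowski_add_right
    minkowski_smul_right

theorem bilin_eq_minkowski {B : LinearMap.BilinForm ℝ (MSpace d)}
    (h : ∀ a b, B (stdVec d a) (stdVec d b) = minkowski (stdVec d a) (stdVec d b))
    (v w : MSpace d) : B v w = minkowski v w := by
  have key : B = minkowskiForm d := by
    refine LinearMap.ext_basis (EuclideanSpace.basisFun (Fin (d + 1)) ℝ).toBasis
      (EuclideanSpace.basisFun (Fin (d + 1)) ℝ).toBasis fun a b => ?_
    rw [basisFun_eq_stdVec, basisFun_eq_stdVec]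
    exact h a b
  rw [key]
  rfl

/-- A symmetric bilinear form of signature `(-, +, …, +)` has a pseudo-orthonormal family. -/
theorem exists_pseudoOrthonormal {B : LinearMap.BilinForm ℝ (MSpace d)}
    (hB : ∀ v w, B v w = B w v)
    (hs : ∃ v, B v v < 0 ∧ ∀ w, w ≠ 0 → B v w = 0 → 0 < B w w) :
    ∃ e : Fin (d + 1) → MSpace d,
      ∀ a b, B (e a) (e b) = minkowski (stdVec d a) (stdVec d b) := by
  obtain ⟨v, hv, hpos⟩ := hs
  -- The orthogonal complement of the timelike vector: it has dimension d and B is positive on it,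
  -- so an orthogonal basis of it can be normalized.
  let W := LinearMap.ker (B v)
  have hW : Module.finrank ℝ W = d := by
    have h : B v ≠ 0 := fun h => by simp [h] at hv
    have h1 := Module.Dual.finrank_ker_add_one_of_ne_zero (f := B v) h
    rw [finrank_euclideanSpace_fin] at h1
    exact Nat.succ_injective h1
  have hsymm : LinearMap.IsSymm (B.restrict W) := ⟨fun x y => hB x y⟩
  obtain ⟨b', hb'⟩ := LinearMap.BilinForm.exists_orthogonal_basis (B := B.restrict W) hsymm
  let b := b'.reindex (finCongr hW)
  have hbo : ∀ i j, i ≠ j → B (b i) (b j) = 0 := by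
    intro i j hij
    have h : B.restrict W (b' ((finCongr hW).symm i)) (b' ((finCongr hW).symm j)) = 0 :=
      hb' (by simpa using hij)
    simpa [b] using h
  have hbp : ∀ i, 0 < B (b i) (b i) := fun i =>
    hpos _ (fun h => b.ne_zero i (Subtype.ext h)) (b i).2
  have hbv : ∀ i, B v (b i) = 0 := fun i => (b i).2
  have hbv' : ∀ i, B (b i) v = 0 := fun i => by rw [hB, hbv]
  refine ⟨Fin.cons ((√(-B v v))⁻¹ • v) fun i => (√(B (b i) (b i)))⁻¹ • (b i : MSpace d), ?_⟩
  intro a c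
  refine Fin.cases ?_ (fun i => ?_) a <;> refine Fin.cases ?_ (fun j => ?_) c
  · have h1 : √(-B v v) ≠ 0 := (Real.sqrt_pos.2 (by linarith)).ne'
    have h2 : √(-B v v) * √(-B v v) = -B v v := Real.mul_self_sqrt (by linarith)
    simp only [Fin.cons_zero, map_smul, LinearMap.smul_apply, smul_eq_mul,
      minkowski_stdVec_zero]
    simp only [stdVec, PiLp.single_apply, if_true]
    field_simp
    rw [pow_two, h2]
    ring
  · rw [minkowski_stdVec_zero]
    simp [hbv, stdVec]
  · rw [minkowski_stdVec_succ]
    simp [hbv', stdVec]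
  · simp only [Fin.cons_succ, map_smul, LinearMap.smul_apply, smul_eq_mul, minkowski_stdVec_succ]
    by_cases hij : i = j
    · subst hij
      have h1 : √(B (b i) (b i)) ≠ 0 := (Real.sqrt_pos.2 (hbp i)).ne'
      have h2 : √(B (b i) (b i)) * √(B (b i) (b i)) = B (b i) (b i) :=
        Real.mul_self_sqrt (hbp i).le
      simp only [stdVec, PiLp.single_apply, if_true]
      field_simp
      rw [pow_two, h2]
    · rw [hbo i j hij]
      simp [stdVec, hij]

end LinearAlgebra

/-! ### Smooth pseudo-orthonormal frame fields -/

section LorentzFrames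

variable {d : ℕ} {M : Type*} [TopologicalSpace M] [ChartedSpace (MSpace d) M]
  [IsManifold 𝓘(ℝ, MSpace d) ∞ M]

open FrameBundle

theorem contMDiffOn_tangentTriv_symmL (x₀ : M) (v : MSpace d) :
    ContMDiffOn 𝓘(ℝ, MSpace d) (𝓘(ℝ, MSpace d).prod 𝓘(ℝ, MSpace d)) ∞
      (fun x => (TotalSpace.mk' (MSpace d) x ((tangentTriv d x₀).symmL ℝ x v) :
        TangentBundle 𝓘(ℝ, MSpace d) M))
      (tangentTriv d x₀).baseSet := by
  have h0 : ContMDiffOn (𝓘(ℝ, MSpace d).prod 𝓘(ℝ, MSpace d))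
      (𝓘(ℝ, MSpace d).prod 𝓘(ℝ, MSpace d)) ∞
      (tangentTriv d x₀).toOpenPartialHomeomorph.symm (tangentTriv d x₀).target :=
    (tangentTriv d x₀).contMDiffOn_symm (n := ∞) (IB := 𝓘(ℝ, MSpace d))
  have h1 : ContMDiff 𝓘(ℝ, MSpace d) (𝓘(ℝ, MSpace d).prod 𝓘(ℝ, MSpace d)) ∞
    (fun x : M => (x, v)) := contMDiff_id.prodMk contMDiff_const
  have h2 : (tangentTriv d x₀).baseSet ⊆ (fun x : M => (x, v)) ⁻¹' (tangentTriv d x₀).target := by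
    intro x hx
    rwa [mem_preimage, Bundle.Trivialization.mem_target]
  refine (h0.comp h1.contMDiffOn h2).congr fun x hx => ?_
  rw [Function.comp_apply,
    Bundle.Trivialization.symm_apply_eq_mk_continuousLinearEquivAt_symm (R := ℝ) _ x hx,
    Bundle.Trivialization.symm_continuousLinearEquivAt_eq]

namespace LorentzMetric

variable (g : LorentzMetric d M)

theorem contMDiffOn_apply {U : Set M} {X Y : ∀ x : M, TangentSpace 𝓘(ℝ, MSpace d) x}
    (hX : ContMDiffOn 𝓘(ℝ, MSpace d) (𝓘(ℝ, MSpace d).prod 𝓘(ℝ, MSpace d)) ∞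
      (fun x => (TotalSpace.mk' (MSpace d) x (X x) : TangentBundle 𝓘(ℝ, MSpace d) M)) U)
    (hY : ContMDiffOn 𝓘(ℝ, MSpace d) (𝓘(ℝ, MSpace d).prod 𝓘(ℝ, MSpace d)) ∞
      (fun x => (TotalSpace.mk' (MSpace d) x (Y x) : TangentBundle 𝓘(ℝ, MSpace d) M)) U) :
    ContMDiffOn 𝓘(ℝ, MSpace d) 𝓘(ℝ, ℝ) ∞ (fun x => g.val x (X x) (Y x)) U := by
  have h : ContMDiffOn 𝓘(ℝ, MSpace d) (𝓘(ℝ, MSpace d).prod 𝓘(ℝ, ℝ)) ∞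
      (fun x => TotalSpace.mk' ℝ (E := Bundle.Trivial M ℝ) x (g.val x (X x) (Y x))) U :=
    ContMDiffOn.clm_bundle_apply₂ (F₁ := MSpace d) (F₂ := MSpace d) g.contMDiff.contMDiffOn hX hY
  intro x hx
  have := h x hx
  simp only [contMDiffWithinAt_totalSpace] at this
  exact this.2

/-- The bilinear form of the metric in the frame `u`. -/
def pullback (u : FrameBundle d M) : LinearMap.BilinForm ℝ (MSpace d) :=
  LinearMap.mk₂ ℝ (fun v w => g.val u.proj (u.toHom v) (u.toHom w))
    (fun v v' w => by simp only [map_add, add_apply])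
    (fun c v w => by simp only [map_smul, smul_apply])
    (fun v w w' => by simp only [map_add])
    (fun c v w => by simp only [map_smul])

theorem mem_orthonormalFrames_iff {u : FrameBundle d M} :
    u ∈ g.orthonormalFrames ↔ ∀ v w, g.val u.proj (u.toHom v) (u.toHom w) = minkowski v w := by
  constructor
  · exact fun h v w => bilin_eq_minkowski (B := g.pullback u) h v w
  · exact fun h a b => h _ _

theorem act_mem_orthonormalFrames_iff {u : FrameBundle d M} (hu : u ∈ g.orthonormalFrames)
    (A : GLGroup d) : u.act A ∈ g.orthonormalFrames ↔ A ∈ lorentzGroup d := by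
  rw [mem_orthonormalFrames_iff] at hu ⊢
  have h : ∀ v w, g.val (u.act A).proj ((u.act A).toHom v) ((u.act A).toHom w) =
      minkowski (A.val v) (A.val w) := fun v w => hu _ _
  simp only [h]
  rfl

/-- There is a pseudo-orthonormal frame at each point. -/
theorem exists_mem_orthonormalFrames (x : M) : ∃ u ∈ g.orthonormalFrames, u.proj = x := by
  let B : LinearMap.BilinForm ℝ (MSpace d) :=
    LinearMap.mk₂ ℝ (fun v w : TangentSpace 𝓘(ℝ, MSpace d) x => g.val x v w)
    (fun v v' w => congrArg (fun φ : TangentSpace 𝓘(ℝ, MSpace d) x →L[ℝ] ℝ => φ w)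
      ((g.val x).map_add v v'))
    (fun c v w => congrArg (fun φ : TangentSpace 𝓘(ℝ, MSpace d) x →L[ℝ] ℝ => φ w)
      ((g.val x).map_smul c v))
    (fun v w w' => (g.val x v).map_add w w')
    (fun c v w => (g.val x v).map_smul c w)
  obtain ⟨e, he⟩ := exists_pseudoOrthonormal (B := B) (g.symm x) (g.signature x)
  let b := (EuclideanSpace.basisFun (Fin (d + 1)) ℝ).toBasis
  let A : MSpace d →ₗ[ℝ] MSpace d := b.constr ℝ e
  have hA : ∀ a, A (stdVec d a) = e a := fun a => by
    rw [← basisFun_eq_stdVec]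
    exact b.constr_basis ℝ e a
  have hBA : ∀ v w, B (A v) (A w) = minkowski v w := by
    refine bilin_eq_minkowski (B := B.compl₁₂ A A) fun a c => ?_
    rw [LinearMap.compl₁₂_apply, hA, hA, he]
  -- A map pulling B back to the nondegenerate form η has trivial kernel.
  have hinj : Function.Injective A := by
    rw [injective_iff_map_eq_zero]
    intro v hv
    refine minkowski_right_injective fun w => ?_
    rw [← hBA, hv, map_zero]
    simp [minkowski]
  have hbij : Function.Bijective A := ⟨hinj, LinearMap.injective_iff_surjective.1 hinj⟩
  refine ⟨⟨⟨x, LinearMap.toContinuousLinearMap A⟩, hbij⟩, ?_, rfl⟩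
  rw [mem_orthonormalFrames_iff]
  exact hBA

/-- The Gram operator of the metric in the trivialization of the tangent bundle around `x₀`. -/
def gram (x₀ x : M) : MSpace d →L[ℝ] MSpace d :=
  ∑ a, ∑ b, g.val x ((tangentTriv d x₀).symmL ℝ x (stdVec d a))
    ((tangentTriv d x₀).symmL ℝ x (stdVec d b)) •
      (innerSL ℝ (stdVec d a)).smulRight (timeReflection d (stdVec d b))

theorem contMDiffOn_gram (x₀ : M) :
    ContMDiffOn 𝓘(ℝ, MSpace d) 𝓘(ℝ, MSpace d →L[ℝ] MSpace d) ∞ (g.gram x₀)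
      (tangentTriv d x₀).baseSet := by
  unfold gram
  refine contMDiffOn_finsetSum fun a _ => contMDiffOn_finsetSum fun b _ => ?_
  exact (g.contMDiffOn_apply (contMDiffOn_tangentTriv_symmL x₀ _)
    (contMDiffOn_tangentTriv_symmL x₀ _)).smul contMDiffOn_const

/-- The b-th coordinate functional is η paired with the reflected b-th basis vector, which explains
the reflection in `gram`. The Gram operator thus represents g through η, so `lorentzAdj` applies to
it. -/
theorem minkowski_gram (x₀ x : M) (v w : MSpace d) : minkowski (g.gram x₀ x v) w =
    g.val x ((tangentTriv d x₀).symmL ℝ x v) ((tangentTriv d x₀).symmL ℝ x w) := by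
  conv_rhs => rw [← sum_smul_stdVec v, ← sum_smul_stdVec w]
  simp only [gram, sum_apply, smul_apply, ContinuousLinearMap.smulRight_apply, innerSL_apply_apply,
    minkowski_sum_left, minkowski_smul_left, timeReflection_stdVec_inner, map_sum, map_smul]
  rw [Finset.sum_comm]
  refine Finset.sum_congr rfl fun b _ => ?_
  rw [Finset.smul_sum]
  refine Finset.sum_congr rfl fun a _ => ?_
  have h : inner ℝ (stdVec d a) v = v a := by
    rw [stdVec, EuclideanSpace.inner_single_left]
    simp
  rw [h]
  simp only [smul_eq_mul]
  ring

theorem gram_mem_lorentzSym (x₀ x : M) : g.gram x₀ x ∈ lorentzSym d := by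
  rw [mem_lorentzSym]
  refine eq_of_minkowski fun v w => ?_
  rw [minkowski_lorentzAdj, minkowski_gram, minkowski_comm v, minkowski_gram, g.symm]

theorem ofCoord_mem_orthonormalFrames_iff {x₀ x : M} (hx : x ∈ (tangentTriv d x₀).baseSet)
    (A : GLGroup d) : ofCoord x₀ x A ∈ g.orthonormalFrames ↔
      lorentzAdj d A.val * g.gram x₀ x * A.val = 1 := by
  have h : ∀ v w, g.val (ofCoord x₀ x A).proj ((ofCoord x₀ x A).toHom v)
      ((ofCoord x₀ x A).toHom w) =
      minkowski v ((lorentzAdj d A.val * g.gram x₀ x * A.val) w) := by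
    intro v w
    rw [mul_apply_eq_comp, mul_apply_eq_comp, minkowski_lorentzAdj, minkowski_comm, minkowski_gram,
      g.symm, ofCoord, dif_pos hx]
    rfl
  rw [mem_orthonormalFrames_iff]
  simp only [h]
  constructor
  · exact fun h => eq_of_minkowski h
  · intro h v w
    rw [h]
    rfl

/-- Every pseudo-orthonormal frame extends to a smooth local pseudo-orthonormal frame field. -/
theorem exists_orthonormal_section {u₀ : FrameBundle d M} (hu₀ : u₀ ∈ g.orthonormalFrames) :
    ∃ U : Set M, IsOpen U ∧ u₀.proj ∈ U ∧ U ⊆ (tangentTriv d u₀.proj).baseSet ∧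
    ∃ S : M → GLGroup d, ContMDiffOn 𝓘(ℝ, MSpace d) 𝓘(ℝ, MSpace d →L[ℝ] MSpace d) ∞ S U ∧
      S u₀.proj = u₀.unitCoord u₀.proj ∧
      ∀ y ∈ U, FrameBundle.ofCoord u₀.proj y (S y) ∈ g.orthonormalFrames := by
  obtain ⟨T, κ, hT, h1, hκs, hκ1, hκ⟩ := exists_lorentz_sqrt_units d
  set x₀ := u₀.proj with hx₀
  set A₀ := u₀.unitCoord x₀ with hA₀
  have hb : x₀ ∈ (tangentTriv d x₀).baseSet := mem_tangentTriv_baseSet x₀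
  -- The Gram operator in the constant frame A₀. It is 1 at x₀, so G and its inverse Γ stay close to
  -- 1 nearby and κ(Γ) is defined.
  let G : M → MSpace d →L[ℝ] MSpace d := fun x =>
    lorentzAdj d A₀.val * g.gram x₀ x * A₀.val
  have hG0 : G x₀ = 1 := by
    rw [← ofCoord_unitCoord (x₀ := x₀) hb] at hu₀
    exact (g.ofCoord_mem_orthonormalFrames_iff hb _).1 hu₀
  have hGs : ContMDiffOn 𝓘(ℝ, MSpace d) 𝓘(ℝ, MSpace d →L[ℝ] MSpace d) ∞ G
      (tangentTriv d x₀).baseSet := by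
    have hc : ContDiff ℝ ∞ (fun X : MSpace d →L[ℝ] MSpace d =>
        lorentzAdj d A₀.val * X * A₀.val) :=
      (contDiff_const.mul contDiff_id).mul contDiff_const
    exact hc.contMDiff.comp_contMDiffOn (g.contMDiffOn_gram x₀)
  have hGsym : ∀ x, lorentzAdj d (G x) = G x := fun x => by
    simp only [G, lorentzAdj_mul, lorentzAdj_lorentzAdj, mem_lorentzSym.1 (g.gram_mem_lorentzSym x₀ x),
      mul_assoc]
  let U₀ : Set M := (tangentTriv d x₀).baseSet ∩ G ⁻¹' {X | IsUnit X}
  have hU₀ : IsOpen U₀ := hGs.continuousOn.isOpen_inter_preimage (tangentTriv d x₀).open_baseSet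
    Units.isOpen
  let Γ : M → GLGroup d := fun x => (unitsLift G x)⁻¹
  have hΓG : ∀ x ∈ U₀, (Γ x).val * G x = 1 := fun x hx => by
    rw [← unitsLift_val (f := G) hx.2]
    exact Units.inv_mul _
  have hGΓ : ∀ x ∈ U₀, G x * (Γ x).val = 1 := fun x hx => by
    rw [← unitsLift_val (f := G) hx.2]
    exact Units.mul_inv _
  have hΓs : ContMDiffOn 𝓘(ℝ, MSpace d) 𝓘(ℝ, MSpace d →L[ℝ] MSpace d) ∞ (fun x => (Γ x).val) U₀ :=
    contMDiffOn_units_iff.1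
      (contMDiffOn_unitsLift (hGs.mono inter_subset_left) fun x hx => hx.2).inv
  have hΓsym : ∀ x ∈ U₀, (Γ x).val ∈ lorentzSym d := fun x hx => by
    rw [mem_lorentzSym]
    have h2 : lorentzAdj d (Γ x).val * G x = 1 := by
      have := congrArg (lorentzAdj d) (hGΓ x hx)
      rwa [lorentzAdj_mul, hGsym, lorentzAdj_one] at this
    calc lorentzAdj d (Γ x).val = lorentzAdj d (Γ x).val * (G x * (Γ x).val) := by
          rw [hGΓ x hx, mul_one]
      _ = (Γ x).val := by rw [← mul_assoc, h2, one_mul]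
  let U : Set M := U₀ ∩ (fun x => (Γ x).val) ⁻¹' T
  have hx₀U₀ : x₀ ∈ U₀ := ⟨hb, by rw [mem_preimage, hG0]; exact isUnit_one⟩
  have hΓ0 : (Γ x₀).val = 1 := by
    have := hΓG x₀ hx₀U₀
    rwa [hG0, mul_one] at this
  refine ⟨U, hΓs.continuousOn.isOpen_inter_preimage hU₀ hT, ⟨hx₀U₀, ?_⟩, fun x hx => hx.1.1,
    fun x => A₀ * κ (Γ x).val, ?_, ?_, ?_⟩
  · rw [mem_preimage, hΓ0]
    exact h1
  · exact contMDiffOn_const.mul (hκs.comp (hΓs.mono inter_subset_left) fun x hx => hx.2)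
  · simp only [hΓ0, hκ1, mul_one]
  · intro y hy
    rw [g.ofCoord_mem_orthonormalFrames_iff hy.1.1]
    have hK := hκ _ hy.2 (hΓsym y hy.1)
    set K := κ (Γ y).val
    -- K K* = Γ = G⁻¹ gives K (K* G K) = K. Cancelling K shows that A₀K is pseudo-orthonormal.
    have h3 : K.val * (lorentzAdj d K.val * G y * K.val) = K.val * 1 := by
      calc _ = (K.val * lorentzAdj d K.val) * G y * K.val := by simp only [mul_assoc]
        _ = K.val * 1 := by rw [hK, hΓG y hy.1, one_mul, mul_one]
    have h4 := (Units.mul_right_inj K).1 h3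
    rw [← h4]
    simp only [G, Units.val_mul, lorentzAdj_mul, mul_assoc]
    rfl

theorem hasSmoothReduction_orthonormalFrames :
    HasSmoothReduction g.orthonormalFrames (lorentzGroup d) where
  exists_section x₀ := by
    obtain ⟨u₀, hu₀, rfl⟩ := g.exists_mem_orthonormalFrames x₀
    obtain ⟨U, hU, hx, hUb, S, hS, -, hSQ⟩ := g.exists_orthonormal_section hu₀
    exact ⟨U, hU, hx, hUb, S, hS, hSQ⟩
  act_mem_iff _ hu A := g.act_mem_orthonormalFrames_iff hu A

end LorentzMetric

theorem HasSmoothReduction.reducesWithSection [T2Space M] {Q : Set (FrameBundle d M)}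
    {H : Subgroup (GLGroup d)} (hQ : HasSmoothReduction Q H) (hH : IsOpenLorentzSubgroup H) :
    ReducesWithSection Q H :=
  ⟨hQ.isReducedSubbundle hH, quotientIsManifold hH, hQ.existsUnique_section⟩

theorem isOpenLorentzSubgroup_lorentzGroup : IsOpenLorentzSubgroup (lorentzGroup d) :=
  ⟨univ, isOpen_univ, fun A => by simp⟩

end LorentzFrames

/-! ### Orientation and time orientation -/

section LinearAlgebra

variable {d : ℕ}

theorem minkowskiForm_nondegenerate : (minkowskiForm d).Nondegenerate := by
  refine LinearMap.BilinForm.Nondegenerate.ofSeparatingLeft fun v hv => ?_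
  refine minkowski_right_injective fun w => ?_
  rw [minkowski_comm, minkowski_comm w]
  exact (hv w).trans (by simp [minkowski])

/-- Take determinants in Aᵀ η A = η and cancel det η ≠ 0. -/
theorem det_sq_of_mem_lorentzGroup {A : GLGroup d} (hA : A ∈ lorentzGroup d) :
    LinearMap.det (A.val : MSpace d →ₗ[ℝ] MSpace d) ^ 2 = 1 := by
  let b := (EuclideanSpace.basisFun (Fin (d + 1)) ℝ).toBasis
  have h0 := (LinearMap.BilinForm.nondegenerate_iff_det_ne_zero b).1
    (minkowskiForm_nondegenerate (d := d))
  have h1 : (minkowskiForm d).comp (A.val : MSpace d →ₗ[ℝ] MSpace d)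
      (A.val : MSpace d →ₗ[ℝ] MSpace d) = minkowskiForm d := by
    refine LinearMap.ext₂ fun v w => ?_
    exact hA v w
  have h2 := congrArg Matrix.det
    ((LinearMap.BilinForm.toMatrix_comp b b (minkowskiForm d) _ _).symm.trans
      (congrArg (LinearMap.BilinForm.toMatrix b) h1))
  rw [Matrix.det_mul, Matrix.det_mul, Matrix.det_transpose, LinearMap.det_toMatrix] at h2
  refine mul_right_cancel₀ h0 ?_
  linarith

theorem det_eq_one_iff_of_mem_lorentzGroup {A : GLGroup d} (hA : A ∈ lorentzGroup d) :
    LinearMap.det (A.val : MSpace d →ₗ[ℝ] MSpace d) = 1 ↔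
      0 < LinearMap.det (A.val : MSpace d →ₗ[ℝ] MSpace d) := by
  refine ⟨fun h => by rw [h]; exact one_pos, fun h => ?_⟩
  rcases mul_self_eq_one_iff.1 ((sq _).symm.trans (det_sq_of_mem_lorentzGroup hA)) with h1 | h1
  · exact h1
  · linarith

theorem continuous_det_val :
    Continuous fun A : GLGroup d => LinearMap.det (A.val : MSpace d →ₗ[ℝ] MSpace d) :=
  ContinuousLinearMap.continuous_det.comp Units.continuous_val

/-- On the Lorentz group the determinant is ±1, so the closed condition det = 1 can be replaced by
the open condition det > 0. -/
theorem isOpenLorentzSubgroup_properOrthochronous :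
    IsOpenLorentzSubgroup (properOrthochronous d) := by
  refine ⟨{A | 0 < LinearMap.det (A.val : MSpace d →ₗ[ℝ] MSpace d)} ∩
    {A | 0 < A.val (stdVec d 0) 0}, ?_, fun A => ?_⟩
  · have h : Continuous fun A : GLGroup d => A.val (stdVec d 0) 0 := by
      have h1 : Continuous fun A : GLGroup d => A.val (stdVec d 0) :=
        Units.continuous_val.clm_apply continuous_const
      exact (EuclideanSpace.proj (𝕜 := ℝ) (0 : Fin (d + 1))).continuous.comp h1
    exact (isOpen_lt continuous_const continuous_det_val).inter (isOpen_lt continuous_const h)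
  · constructor
    · rintro ⟨hA, h1, h2⟩
      exact ⟨hA, (det_eq_one_iff_of_mem_lorentzGroup hA).1 h1, h2⟩
    · rintro ⟨hA, h1, h2⟩
      exact ⟨hA, (det_eq_one_iff_of_mem_lorentzGroup hA).2 h1, h2⟩

/-- Two timelike vectors lie in the same cone if and only if their product is negative. -/
theorem minkowski_neg_iff {a b : MSpace d} (ha : minkowski a a < 0) (hb : minkowski b b < 0) :
    minkowski a b < 0 ↔ 0 < a 0 * b 0 := by
  unfold minkowski at *
  have hcs := Finset.sum_mul_sq_le_sq_mul_sq Finset.univ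
    (fun i : Fin d => a i.succ) (fun i : Fin d => b i.succ)
  set S := ∑ i : Fin d, a i.succ * b i.succ
  have hA : ∑ i : Fin d, a i.succ ^ 2 < a 0 ^ 2 := by
    simp only [pow_two]; linarith
  have hB : ∑ i : Fin d, b i.succ ^ 2 < b 0 ^ 2 := by
    simp only [pow_two]; linarith
  have hA0 : 0 ≤ ∑ i : Fin d, a i.succ ^ 2 := Finset.sum_nonneg fun i _ => sq_nonneg _
  have hB0 : 0 ≤ ∑ i : Fin d, b i.succ ^ 2 := Finset.sum_nonneg fun i _ => sq_nonneg _
  have h1 : S ^ 2 < (a 0 * b 0) ^ 2 := by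
    calc S ^ 2 ≤ _ := hcs
      _ < a 0 ^ 2 * b 0 ^ 2 := mul_lt_mul'' hA hB hA0 hB0
      _ = _ := by ring
  have h2 := abs_lt.1 (sq_lt_sq.1 h1)
  constructor
  · intro h
    by_contra! h3
    rw [abs_of_nonpos h3] at h2
    linarith
  · intro h
    rw [abs_of_pos h] at h2
    linarith

/-- By `minkowski_neg_iff`, a negative product of timelike vectors means equal signs of their time
components, and sign agreement is transitive. -/
theorem minkowski_neg_iff_of_neg {a b c : MSpace d} (ha : minkowski a a < 0)
    (hb : minkowski b b < 0) (hc : minkowski c c < 0) (hab : minkowski a b < 0) :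
    minkowski a c < 0 ↔ minkowski b c < 0 := by
  rw [minkowski_neg_iff ha hb] at hab
  rw [minkowski_neg_iff ha hc, minkowski_neg_iff hb hc]
  rcases mul_pos_iff.1 hab with ⟨h1, h2⟩ | ⟨h1, h2⟩
  · rw [mul_pos_iff_of_pos_left h1, mul_pos_iff_of_pos_left h2]
  · simp only [mul_pos_iff, h1, h2, h1.not_gt, h2.not_gt, true_and, false_and, false_or]

/-- The diagonal operator with entries `c`. -/
def diagonalMap (c : Fin (d + 1) → ℝ) : MSpace d →L[ℝ] MSpace d :=
  LinearMap.toContinuousLinearMap (Matrix.toLin (EuclideanSpace.basisFun (Fin (d + 1)) ℝ).toBasis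
    (EuclideanSpace.basisFun (Fin (d + 1)) ℝ).toBasis (Matrix.diagonal c))

theorem diagonalMap_apply (c : Fin (d + 1) → ℝ) (v : MSpace d) (i : Fin (d + 1)) :
    diagonalMap c v i = c i * v i := by
  simp [diagonalMap, Matrix.toLin_apply, Matrix.mulVec_diagonal, Finset.sum_apply, Pi.single_apply]

theorem det_diagonalMap (c : Fin (d + 1) → ℝ) :
    LinearMap.det (diagonalMap c : MSpace d →ₗ[ℝ] MSpace d) = ∏ i, c i := by
  have h := LinearMap.det_toLin (EuclideanSpace.basisFun (Fin (d + 1)) ℝ).toBasis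
    (Matrix.diagonal c)
  rw [Matrix.det_diagonal] at h
  exact h

/-- Diagonal operators with entries `±1`. -/
theorem exists_diagonal_mem_lorentzGroup {c : Fin (d + 1) → ℝ} (hc : ∀ i, c i * c i = 1) :
    ∃ A ∈ lorentzGroup d, A.val = diagonalMap c := by
  have h : diagonalMap c * diagonalMap c = 1 := by
    ext v i
    rw [mul_apply_eq_comp, diagonalMap_apply, diagonalMap_apply, ← mul_assoc, hc, one_mul,
      one_apply_eq_self]
  refine ⟨⟨diagonalMap c, diagonalMap c, h, h⟩, fun v w => ?_, rfl⟩
  simp only [minkowski, diagonalMap_apply, mul_mul_mul_comm (c _), hc, one_mul]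

end LinearAlgebra

/-! ### Frames adapted to an orientation and a time orientation -/

section OrientedFrames

variable {d : ℕ} {M : Type*} [TopologicalSpace M] [ChartedSpace (MSpace d) M]
  [IsManifold 𝓘(ℝ, MSpace d) ∞ M]

open FrameBundle

namespace FrameBundle

theorem basis_apply (u : FrameBundle d M) (a : Fin (d + 1)) : u.basis a = u.vec a := by
  rw [basis, Module.Basis.map_apply, basisFun_eq_stdVec]
  rfl

/-- Transport by u⁻¹ turns the basis of u into the standard basis and that of u·A into the columns
of A. -/
theorem basis_det_act (u : FrameBundle d M) (A : GLGroup d) :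
    u.basis.det (u.act A).basis = LinearMap.det (A.val : MSpace d →ₗ[ℝ] MSpace d) := by
  let b := (EuclideanSpace.basisFun (Fin (d + 1)) ℝ).toBasis
  let f := LinearEquiv.ofBijective
    (u.toHom : MSpace d →ₗ[ℝ] TangentSpace 𝓘(ℝ, MSpace d) u.proj) u.2
  have h : (⇑f.symm ∘ fun a => (u.act A).basis a) =
      (A.val : MSpace d →ₗ[ℝ] MSpace d) ∘ b := by
    funext a
    refine f.symm_apply_eq.2 ((basis_apply (u.act A) a).trans ?_)
    rw [Function.comp_apply, basisFun_eq_stdVec]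
    rfl
  have h1 := Module.Basis.det_map b f (fun a => (u.act A).basis a)
  rw [h, Module.Basis.det_comp, Module.Basis.det_self, mul_one] at h1
  exact h1

/-- The orientation of a frame is unchanged under operators of positive determinant. -/
theorem orientation_act_eq_iff (u : FrameBundle d M) (A : GLGroup d) :
    (u.act A).basis.orientation = u.basis.orientation ↔
      0 < LinearMap.det (A.val : MSpace d →ₗ[ℝ] MSpace d) := by
  rw [← basis_det_act u A]
  exact eq_comm.trans (Module.Basis.orientation_eq_iff_det_pos u.basis (u.act A).basis)

theorem continuousOn_tangentTriv_symmL (x₀ : M) {U : Set M} (hU : U ⊆ (tangentTriv d x₀).baseSet)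
    {f : M → MSpace d} (hf : ContinuousOn f U) :
    ContinuousOn (fun x => (TotalSpace.mk' (MSpace d) x ((tangentTriv d x₀).symmL ℝ x (f x)) :
        TangentBundle 𝓘(ℝ, MSpace d) M)) U := by
  have h1 : ContinuousOn (fun x : M => (x, f x)) U := continuousOn_id.prodMk hf
  have h2 : MapsTo (fun x : M => (x, f x)) U (tangentTriv d x₀).target := by
    intro x hx
    rw [Bundle.Trivialization.mem_target]
    exact hU hx
  refine ((tangentTriv d x₀).toOpenPartialHomeomorph.continuousOn_symm.comp h1 h2).congr
    fun x hx => ?_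
  rw [Function.comp_apply]
  refine Eq.symm ?_
  rw [← Bundle.Trivialization.symm_continuousLinearEquivAt_eq _ (hU hx)]
  exact Bundle.Trivialization.symm_apply_eq_mk_continuousLinearEquivAt_symm (R := ℝ) _ x (hU hx) _

end FrameBundle

namespace LorentzMetric

variable (g : LorentzMetric d M)

theorem continuousOn_apply {U : Set M} {X Y : ∀ x : M, TangentSpace 𝓘(ℝ, MSpace d) x}
    (hX : ContinuousOn
      (fun x => (TotalSpace.mk' (MSpace d) x (X x) : TangentBundle 𝓘(ℝ, MSpace d) M)) U)
    (hY : ContinuousOn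
      (fun x => (TotalSpace.mk' (MSpace d) x (Y x) : TangentBundle 𝓘(ℝ, MSpace d) M)) U) :
    ContinuousOn (fun x => g.val x (X x) (Y x)) U := by
  have h : ContinuousOn
      (fun x => TotalSpace.mk' ℝ (E := Bundle.Trivial M ℝ) x (g.val x (X x) (Y x))) U :=
    ContinuousOn.clm_bundle_apply₂ (F₁ := MSpace d) (F₂ := MSpace d)
      g.contMDiff.continuous.continuousOn hX hY
  intro x hx
  have := h x hx
  simp only [FiberBundle.continuousWithinAt_totalSpace] at this
  exact this.2

variable {g}

/-- Any future vector can replace the one that defines the cone. A pseudo-orthonormal frame reduces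
this to `minkowski_neg_iff_of_neg`. -/
theorem mem_future_iff (τ : TimeOrientation g) {x : M} {e w : TangentSpace 𝓘(ℝ, MSpace d) x}
    (he : e ∈ τ.future x) (hw : g.val x w w < 0) : w ∈ τ.future x ↔ g.val x e w < 0 := by
  obtain ⟨u, hu, rfl⟩ := g.exists_mem_orthonormalFrames x
  rw [mem_orthonormalFrames_iff] at hu
  obtain ⟨v, hv, hf⟩ := τ.isCone u.proj
  have hs : Function.Surjective u.toHom := Function.Bijective.surjective u.2
  rw [hf] at he ⊢
  obtain ⟨he1, he2⟩ := he
  obtain ⟨a, rfl⟩ := hs v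
  obtain ⟨b, rfl⟩ := hs e
  obtain ⟨c, rfl⟩ := hs w
  rw [hu] at hv he1 he2 hw
  have key := minkowski_neg_iff_of_neg hv he1 hw he2
  rw [← hu, ← hu] at key
  refine Iff.trans ⟨fun h => h.2, fun h => ⟨by rwa [hu], h⟩⟩ key

theorem vec_zero_neg {u : FrameBundle d M} (hu : u ∈ g.orthonormalFrames) :
    g.val u.proj (u.vec 0) (u.vec 0) < 0 := by
  have h : minkowski (stdVec d 0) (stdVec d 0) < 0 := by
    rw [minkowski_stdVec_zero]
    simp [stdVec]
  exact lt_of_eq_of_lt (hu 0 0) h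

theorem act_vec_zero_mem_future_iff (τ : TimeOrientation g) {u : FrameBundle d M}
    (hu : u ∈ g.orthonormalFrames) (hτ : u.vec 0 ∈ τ.future u.proj) {A : GLGroup d}
    (hA : A ∈ lorentzGroup d) :
    (u.act A).vec 0 ∈ τ.future (u.act A).proj ↔ 0 < A.val (stdVec d 0) 0 := by
  have h1 := vec_zero_neg ((g.act_mem_orthonormalFrames_iff hu A).2 hA)
  have h2 : g.val u.proj (u.vec 0) ((u.act A).vec 0) = -(A.val (stdVec d 0) 0) :=
    (g.mem_orthonormalFrames_iff.1 hu _ _).trans (minkowski_stdVec_zero _)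
  refine (mem_future_iff τ hτ h1).trans ?_
  rw [h2, neg_lt_zero]

theorem act_mem_orientedFrames_iff (o : ManifoldOrientation d M) (τ : TimeOrientation g)
    {u : FrameBundle d M} (hu : u ∈ g.orientedFrames o τ) (A : GLGroup d) :
    u.act A ∈ g.orientedFrames o τ ↔ A ∈ properOrthochronous d := by
  obtain ⟨h1, h2, h3⟩ := hu
  have e1 := g.act_mem_orthonormalFrames_iff h1 A
  have e2 : (u.act A).basis.orientation = o.val (u.act A).proj ↔
      0 < LinearMap.det (A.val : MSpace d →ₗ[ℝ] MSpace d) := by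
    rw [← orientation_act_eq_iff u A, h2]
    rfl
  constructor
  · rintro ⟨k1, k2, k3⟩
    have hA := e1.1 k1
    exact ⟨hA, (det_eq_one_iff_of_mem_lorentzGroup hA).2 (e2.1 k2),
      (act_vec_zero_mem_future_iff τ h1 h3 hA).1 k3⟩
  · rintro ⟨hA, k2, k3⟩
    exact ⟨e1.2 hA, e2.2 ((det_eq_one_iff_of_mem_lorentzGroup hA).1 k2),
      (act_vec_zero_mem_future_iff τ h1 h3 hA).2 k3⟩

/-- If e₀ is not future pointing, acting by −1, a Lorentz transformation, reverses it. -/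
theorem exists_future_frame (τ : TimeOrientation g) (x : M) :
    ∃ u ∈ g.orthonormalFrames, u.proj = x ∧ u.vec 0 ∈ τ.future u.proj := by
  obtain ⟨u, hu, rfl⟩ := g.exists_mem_orthonormalFrames x
  by_cases h : u.vec 0 ∈ τ.future u.proj
  · exact ⟨u, hu, rfl, h⟩
  · obtain ⟨A, hA, hAc⟩ := exists_diagonal_mem_lorentzGroup (d := d) (c := fun _ => -1)
      fun _ => by norm_num
    have hAv : ∀ v, A.val v = -v := fun v => by
      ext i
      rw [hAc, diagonalMap_apply]
      simp
    have hA1 := (g.act_mem_orthonormalFrames_iff hu A).2 hA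
    refine ⟨u.act A, hA1, rfl, ?_⟩
    obtain ⟨v, hv, hf⟩ := τ.isCone u.proj
    have e1 : (u.act A).vec 0 = -u.vec 0 :=
      (congrArg u.toHom (hAv (stdVec d 0))).trans (map_neg _ _)
    -- A vector orthogonal to e₀ has no time component in this frame, so it cannot be timelike.
    have h1 : g.val u.proj v (u.vec 0) ≠ 0 := by
      obtain ⟨a, rfl⟩ := (show Function.Surjective u.toHom from Function.Bijective.surjective u.2) v
      rw [g.mem_orthonormalFrames_iff.1 hu] at hv
      refine ne_of_eq_of_ne (g.mem_orthonormalFrames_iff.1 hu _ _) ?_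
      rw [minkowski_comm, minkowski_stdVec_zero, neg_ne_zero]
      intro ha
      have h2 : 0 ≤ ∑ i : Fin d, a i.succ * a i.succ :=
        Finset.sum_nonneg fun i _ => mul_self_nonneg _
      rw [minkowski, ha] at hv
      linarith
    have h2 : 0 ≤ g.val u.proj v (u.vec 0) := by
      by_contra! h3
      exact h (hf ▸ ⟨vec_zero_neg hu, h3⟩)
    have h3 : g.val u.proj v ((u.act A).vec 0) = -g.val u.proj v (u.vec 0) :=
      (congrArg (g.val u.proj v) e1).trans (map_neg _ _)
    refine (Set.ext_iff.1 hf _).2 ⟨vec_zero_neg hA1, ?_⟩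
    rw [h3, neg_lt_zero]
    exact lt_of_le_of_ne h2 h1.symm

/-- Reflecting the last axis has determinant −1, so it corrects the orientation. As d ≥ 1 this axis
is spacelike, and e₀ stays fixed. -/
theorem exists_mem_orientedFrames (hd : 1 ≤ d) (o : ManifoldOrientation d M)
    (τ : TimeOrientation g) (x : M) : ∃ u ∈ g.orientedFrames o τ, u.proj = x := by
  obtain ⟨u, hu, rfl, hτ⟩ := exists_future_frame τ x
  by_cases h : u.basis.orientation = o.val u.proj
  · exact ⟨u, ⟨hu, h, hτ⟩, rfl⟩
  · let i : Fin (d + 1) := Fin.last d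
    have hi : (0 : Fin (d + 1)) ≠ i := by
      intro h
      have := congrArg Fin.val h
      simp [i] at this
      omega
    obtain ⟨A, hA, hAc⟩ := exists_diagonal_mem_lorentzGroup (d := d)
      (c := fun j => if j = i then -1 else 1) fun j => by split_ifs <;> norm_num
    have hdet : LinearMap.det (A.val : MSpace d →ₗ[ℝ] MSpace d) = -1 := by
      rw [hAc, det_diagonalMap]
      simp
    have ho : (u.act A).basis.orientation ≠ u.basis.orientation := by
      intro h
      have h1 := (orientation_act_eq_iff u A).1 h
      rw [hdet] at h1
      linarith
    refine ⟨u.act A, ⟨(g.act_mem_orthonormalFrames_iff hu A).2 hA, ?_,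
      (act_vec_zero_mem_future_iff τ hu hτ hA).2 ?_⟩, rfl⟩
    · have h1 := (u.basis.orientation_ne_iff_eq_neg _).1 ho
      have h2 := (u.basis.orientation_ne_iff_eq_neg _).1 (Ne.symm h)
      exact h1.trans h2.symm
    · rw [hAc, diagonalMap_apply, if_neg hi]
      simp [stdVec]

/-- Compare with a continuous positively oriented field σ: the determinant D of the change of frame
is continuous, and D > 0 characterizes the right orientation. -/
theorem eventually_orientation_eq (o : ManifoldOrientation d M) {x₀ : M} {U : Set M}
    (hU : IsOpen U) (hx₀ : x₀ ∈ U) (hUb : U ⊆ (tangentTriv d x₀).baseSet) {S : M → GLGroup d}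
    (hS : ContinuousOn S U)
    (h₀ : (ofCoord x₀ x₀ (S x₀)).basis.orientation = o.val (ofCoord x₀ x₀ (S x₀)).proj) :
    ∀ᶠ y in 𝓝 x₀, (ofCoord x₀ y (S y)).basis.orientation = o.val (ofCoord x₀ y (S y)).proj := by
  obtain ⟨U₁, hU₁, hx₁, σ, hσ, hσo⟩ := o.continuous x₀
  let V : Set U₁ := Subtype.val ⁻¹' U
  let D : U₁ → ℝ := fun y => LinearMap.det
    ((((σ y).unitCoord x₀)⁻¹ * S y : GLGroup d).val : MSpace d →ₗ[ℝ] MSpace d)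
  have hD : ContinuousOn D V := by
    refine continuous_det_val.comp_continuousOn (ContinuousOn.mul (ContinuousOn.inv ?_) ?_)
    · refine (contMDiffOn_unitCoord x₀).continuousOn.comp hσ.continuousOn fun y hy => ?_
      rw [mem_preimage, (hσo y).1]
      exact hUb hy
    · exact hS.comp continuous_subtype_val.continuousOn fun y hy => hy
  have key : ∀ y ∈ V, ((ofCoord x₀ y (S y)).basis.orientation =
      o.val (ofCoord x₀ (y : M) (S y)).proj ↔ 0 < D y) := by
    intro y hy
    have hp : (σ y).proj ∈ (tangentTriv d x₀).baseSet := by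
      rw [(hσo y).1]
      exact hUb hy
    have e : ofCoord x₀ y (S y) = (σ y).act (((σ y).unitCoord x₀)⁻¹ * S y) := by
      have h1 := ofCoord_act hp ((σ y).unitCoord x₀) (((σ y).unitCoord x₀)⁻¹ * S y)
      rw [ofCoord_unitCoord hp, mul_inv_cancel_left, (hσo y).1] at h1
      exact h1.symm
    rw [e]
    refine Iff.trans ?_ (orientation_act_eq_iff (σ y) _)
    rw [(hσo y).2]
    rfl
  have hV : IsOpen V := hU.preimage continuous_subtype_val
  have hO : IsOpen (V ∩ D ⁻¹' Ioi 0) := hD.isOpen_inter_preimage hV isOpen_Ioi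
  have hO' : IsOpen (Subtype.val '' (V ∩ D ⁻¹' Ioi 0)) := hU₁.isOpenMap_subtype_val _ hO
  refine Filter.mem_of_superset (hO'.mem_nhds
    ⟨⟨x₀, hx₁⟩, ⟨hx₀, (key ⟨x₀, hx₁⟩ hx₀).1 h₀⟩, rfl⟩) ?_
  rintro _ ⟨y, ⟨hy, hDy⟩, rfl⟩
  exact (key y hy).2 hDy

theorem ofCoord_vec_zero_mem_future_iff (τ : TimeOrientation g) {x₀ y : M}
    (hy : y ∈ (tangentTriv d x₀).baseSet) {A : GLGroup d}
    (hA : ofCoord x₀ y A ∈ g.orthonormalFrames) {X : TangentSpace 𝓘(ℝ, MSpace d) y}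
    (hX : X ∈ τ.future y) :
    (ofCoord x₀ y A).vec 0 ∈ τ.future (ofCoord x₀ y A).proj ↔
      g.val y X ((tangentTriv d x₀).symmL ℝ y (A.val (stdVec d 0))) < 0 := by
  have h := vec_zero_neg hA
  rw [ofCoord, dif_pos hy] at h ⊢
  exact mem_future_iff τ hX h

/-- With X a continuous future field near x₀, e₀ is future pointing exactly where the continuous
function g(X, e₀) is negative. -/
theorem eventually_mem_future (τ : TimeOrientation g) {x₀ : M} {U : Set M}
    (hU : IsOpen U) (hx₀ : x₀ ∈ U) (hUb : U ⊆ (tangentTriv d x₀).baseSet) {S : M → GLGroup d}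
    (hS : ContinuousOn S U) (hg : ∀ y ∈ U, ofCoord x₀ y (S y) ∈ g.orthonormalFrames)
    (h₀ : (ofCoord x₀ x₀ (S x₀)).vec 0 ∈ τ.future (ofCoord x₀ x₀ (S x₀)).proj) :
    ∀ᶠ y in 𝓝 x₀, (ofCoord x₀ y (S y)).vec 0 ∈ τ.future (ofCoord x₀ y (S y)).proj := by
  obtain ⟨U₁, hU₁, hx₁, X, hX, hXf⟩ := τ.continuous x₀
  let D : M → ℝ := fun y => g.val y (X y)
    ((tangentTriv d x₀).symmL ℝ y ((S y).val (stdVec d 0)))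
  have hD : ContinuousOn D (U ∩ U₁) := by
    refine g.continuousOn_apply (hX.mono inter_subset_right)
      (continuousOn_tangentTriv_symmL x₀ (inter_subset_left.trans hUb) ?_)
    exact ((Units.continuous_val.comp_continuousOn hS).mono inter_subset_left).clm_apply
      continuousOn_const
  have key : ∀ y ∈ U ∩ U₁, ((ofCoord x₀ y (S y)).vec 0 ∈ τ.future (ofCoord x₀ y (S y)).proj ↔
      D y < 0) := fun y hy =>
    ofCoord_vec_zero_mem_future_iff τ (hUb hy.1) (hg y hy.1) (hXf y hy.2)
  have hO : IsOpen ((U ∩ U₁) ∩ D ⁻¹' Iio 0) :=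
    hD.isOpen_inter_preimage (hU.inter hU₁) isOpen_Iio
  refine Filter.mem_of_superset (hO.mem_nhds ⟨⟨hx₀, hx₁⟩, (key x₀ ⟨hx₀, hx₁⟩).1 h₀⟩) ?_
  rintro y ⟨hy, hDy⟩
  exact (key y hy).2 hDy

/-- A smooth pseudo-orthonormal field through a correctly oriented frame stays correctly oriented
after shrinking its domain. -/
theorem hasSmoothReduction_orientedFrames (hd : 1 ≤ d) (o : ManifoldOrientation d M)
    (τ : TimeOrientation g) :
    HasSmoothReduction (g.orientedFrames o τ) (properOrthochronous d) where
  exists_section x₀ := by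
    obtain ⟨u₀, ⟨hu₀, huo, huτ⟩, rfl⟩ := exists_mem_orientedFrames hd o τ x₀
    obtain ⟨U, hU, hx, hUb, S, hS, hS₀, hSQ⟩ := g.exists_orthonormal_section hu₀
    have e : ofCoord u₀.proj u₀.proj (S u₀.proj) = u₀ := by
      rw [hS₀]
      exact ofCoord_unitCoord (hUb hx)
    have h1 := eventually_orientation_eq o hU hx hUb hS.continuousOn (by rw [e]; exact huo)
    have h2 := eventually_mem_future τ hU hx hUb hS.continuousOn hSQ (by rw [e]; exact huτ)
    obtain ⟨V, hV, hVo, hxV⟩ := mem_nhds_iff.1 (h1.and h2)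
    exact ⟨U ∩ V, hU.inter hVo, ⟨hx, hxV⟩, inter_subset_left.trans hUb, S,
      hS.mono inter_subset_left, fun y hy => ⟨hSQ y hy.1, hV hy.2⟩⟩
  act_mem_iff _ hu A := act_mem_orientedFrames_iff o τ hu A

end LorentzMetric

end OrientedFrames

end

theorem mainTheorem2 (d : ℕ) (hd : 1 ≤ d) (M : Type*) [TopologicalSpace M] [T2Space M]
    [ChartedSpace (MSpace d) M] [IsManifold 𝓘(ℝ, MSpace d) ∞ M] (g : LorentzMetric d M) :
    ReducesWithSection g.orthonormalFrames (lorentzGroup d) ∧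
      ∀ (o : ManifoldOrientation d M) (τ : TimeOrientation g),
        ReducesWithSection (g.orientedFrames o τ) (properOrthochronous d) :=
  ⟨g.hasSmoothReduction_orthonormalFrames.reducesWithSection isOpenLorentzSubgroup_lorentzGroup,
    fun o τ => (LorentzMetric.hasSmoothReduction_orientedFrames hd o τ).reducesWithSection
      isOpenLorentzSubgroup_properOrthochronous⟩
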